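/- All graphs are finite and simple. For graphs $F,G$, say that $G$ is $F$-hom-free if there is no homomorphism from $F$ to $G$. A map $f:V(G)\to V(\Gamma)$ is an $\varepsilon$-approximate homomorphism if it maps all but at most $\varepsilon|V(G)|^2$ edges of $G$ to edges of $\Gamma$. For odd $\ell\ge 3$ and $\varepsilon>0$, let $M_{K_3,C_\ell}(\varepsilon)$ be the smallest integer $M$ such that every $C_\ell$-hom-free graph has an $\varepsilon$-approximate homomorphism to a $K_3$-hom-free (i.e. triangle-free) graph on at most $M$ vertices. **Theorem 1.7.** For every odd $\ell\ge 3$ and every $\varepsilon>0$, such a smallest integer $M_{K_3,C_\ell}(\varepsilon)$ exists. Moreover: 1. ($\ell=3$: superexponential.) For all $A,B>0$ we have $M_{K_3,C_3}(\varepsilon)>2^{A(1/\varepsilon)^B}$ for all sufficiently small $\varepsilon>0$. Quantitatively, there is a constant $c>0$ such that $M_{K_3,C_3}(\varepsilon)\ge 2^{(1/\varepsilon)^{c\log_2(1/\varepsilon)}}$ for all sufficiently small $\varepsilon>0$. 2. ($\ell\in\{5,7\}$: $2^{\mathrm{poly}(1/\varepsilon)}$.) There are constants $a,b,A,B>0$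 such that $M_{K_3,C_\ell}(\varepsilon)\ge 2^{a(1/\varepsilon)^b}$ for all sufficiently small $\varepsilon>0$ and $M_{K_3,C_\ell}(\varepsilon)\le 2^{A(1/\varepsilon)^B}$ for all $0<\varepsilon\le 1$. 3. ($\ell\ge 9$ odd: linear.) There is an absolute constant $C>0$ such that $M_{K_3,C_\ell}(\varepsilon)\le C/\varepsilon$ for all odd $\ell\ge 9$ and all $0<\varepsilon\le 1$. -/

import Mathlib

open Filter Topology

namespace AsymHom

/-- `G` is `F`-hom-free: there is no homomorphism from `F` to `G`. -/
def HomFree {U V : Type} (F : SimpleGraph U) (G : SimpleGraph V) : Prop :=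
  IsEmpty (F →g G)

/-- `f` is an `ε`-approximate homomorphism from `G` to `Γ`: at most `ε |G|²` edges of `G` are not
mapped to edges of `Γ`. (Edges are unordered pairs; an edge whose end points are identified by `f`
is not mapped to an edge.) -/
def IsApproxHom {V W : Type} [Fintype V] (ε : ℝ) (G : SimpleGraph V) (Γ : SimpleGraph W)
    (f : V → W) : Prop :=
  (({e ∈ G.edgeSet | Sym2.map f e ∉ Γ.edgeSet}.ncard : ℕ) : ℝ) ≤ ε * (Fintype.card V : ℝ) ^ 2

/-- Every finite `H`-hom-free graph has an `ε`-approximate homomorphism to an `F`-hom-free graph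
on at most `M` vertices. -/
def IsSizeBound {U U' : Type} (F : SimpleGraph U) (H : SimpleGraph U') (ε : ℝ) (M : ℕ) : Prop :=
  ∀ (V : Type) [Fintype V] (G : SimpleGraph V), HomFree H G →
    ∃ (W : Type) (_ : Fintype W) (Γ : SimpleGraph W) (f : V → W),
      Fintype.card W ≤ M ∧ HomFree F Γ ∧ IsApproxHom ε G Γ f

/-- `M_{F,H}(ε)`: the smallest `M` with `IsSizeBound F H ε M`. (If there were no such `M`, this
would be the junk value `0`; it is used together with the assertion that the minimum exists.) -/
noncomputable def minSize {U U' : Type} (F : SimpleGraph U) (H : SimpleGraph U') (ε : ℝ) : ℕ :=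
  sInf {M : ℕ | IsSizeBound F H ε M}

/-- `M_{K₃,C_ℓ}(ε)`. -/
noncomputable def triangleCycleSize (ℓ : ℕ) (ε : ℝ) : ℕ :=
  minSize (SimpleGraph.completeGraph (Fin 3)) (SimpleGraph.cycleGraph ℓ) ε

end AsymHom

/-!
The four regimes come from two constructions of approximate homomorphisms and one family of graphs
without good ones. Throughout, a homomorphic image of `C_ℓ` is a closed walk of length `ℓ`, so the
condition of being `C_ℓ`-hom-free gets weaker, and the minimum larger, as the odd number `ℓ`
decreases. Existence of the minimum thus only has to be shown for `ℓ = 3`, where it is the usual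
combination of Szemerédi's regularity lemma with the triangle counting lemma.

*Linear upper bound for `ℓ ≥ 9`* (`isSizeBound_of_nine_le`). The neighbourhoods of at most
`1 / ε` greedily chosen vertices contain both ends of all but few edges. Send every covered vertex to
one of its neighbours among the chosen ones. Vertices with the same image have a common neighbour, so
a triangle in the image lifts to a closed walk of length `3 + 3 * 2 = 9`.

*Exponential upper bound for `ℓ = 5`* (`isSizeBound_five`). A weakly regular (Frieze–Kannan) partition
has `2 ^ poly (1 / δ)` classes, and replacing the graph by its averages over pairs of classes changes
the density of pentagons by `O(δ)` only. Choose a maximal fractional packing of triangles in the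
averaged graph and delete all saturated pairs of classes; no triangle survives. The total weight `m` of
the packing bounds the loss, and it is small by the inequality `m ^ 8 ≤ n ^ 11 * #pentagons`
(`IsTrianglePacking.pow_eight_le`), a polynomial removal lemma in which triangles are controlled by
pentagons. The case `ℓ = 7` follows.

*Lower bounds.* Start from a linear system of triples on a set `B` and replace every point by a cube
`{0, 1} ^ T`, with one coordinate for every triple (`TripleSystem.blowUp`). The coordinate `t` of a
vertex over a corner of `t` decides which of the other two corners it sees. Hence a closed walk in the
blow-up cannot simply go round a triple; it needs a detour at each of the three corners, and if the
triple system has no other short cycles, then there are no odd closed walks of length less than nine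
(`homFree_seven_blowUp`); if only its triangles are controlled, the blow-up is still triangle-free
(`homFree_three_blowUp`). On the other hand a colouring of a cube with `M` colours is balanced in all
but `O(log M)` coordinates (`pow_card_unbalanced_le`), and where the colouring is balanced at the three
corners of a triple, a triangle-free target graph must lose a fixed proportion of the edges of this
triple (`le_card_lostArcs`). So `log M` is at least of the order of the degree of the triple system
(`not_isSizeBound_of_blowUp`). The systems of Ruzsa–Szemerédi type given by Behrend's sets without
three-term progressions yield the bound for `ℓ = 3`, and greedily constructed systems of girth greater
than seven (`exists_hasLargeGirth`) yield the bound for `ℓ = 7`, and hence for `ℓ = 5`.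
-/

namespace AsymHom

/-! ### Closed walks and homomorphisms from cycles -/

/-- Going round a closed walk of length `k` and then back and forth along one of its edges turns it
into a homomorphic image of any longer cycle of the same parity. -/
lemma not_homFree_cycleGraph_of_closedWalk {V : Type} {G : SimpleGraph V} {k ℓ : ℕ} (hk : 2 ≤ k)
    (hkl : k ≤ ℓ) (hpar : Even (ℓ - k)) (v : ℕ → V)
    (hv : ∀ i, i + 1 < k → G.Adj (v i) (v (i + 1))) (hv' : G.Adj (v (k - 1)) (v 0)) :
    ¬ HomFree (SimpleGraph.cycleGraph ℓ) G := by
  intro hfree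
  obtain ⟨l, rfl⟩ : ∃ l, ℓ = l + 2 := ⟨ℓ - 2, by omega⟩
  let w : ℕ → V := fun i => if i < k then v i else if Even (i - k) then v 0 else v (k - 1)
  have hw : ∀ i, i + 1 < l + 2 → G.Adj (w i) (w (i + 1)) := by
    intro i _
    simp only [w]
    rcases lt_trichotomy (i + 1) k with h | h | h
    · rw [if_pos (show i < k by omega), if_pos h]; exact hv i h
    · rw [if_pos (show i < k by omega), if_neg (show ¬ i + 1 < k by omega), if_pos (by simp [h])]
      have : i = k - 1 := by omega
      rw [this]; exact hv'
    · have h1 : i + 1 - k = (i - k) + 1 := by omega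
      rw [if_neg (show ¬ i < k by omega), if_neg (show ¬ i + 1 < k by omega), h1]
      by_cases he : Even (i - k)
      · rw [if_pos he, if_neg (by simpa [Nat.even_add_one] using he)]; exact hv'.symm
      · rw [if_neg he, if_pos (by simpa [Nat.even_add_one] using he)]; exact hv'
  have hw' : G.Adj (w (l + 1)) (w 0) := by
    simp only [w]
    rw [if_pos (show 0 < k by omega)]
    by_cases h : l + 1 < k
    · rw [if_pos h]
      have : l + 1 = k - 1 := by omega
      rw [this]; exact hv'
    · rw [if_neg h, if_neg]
      · exact hv'
      · rw [Nat.even_iff] at hpar ⊢; omega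
  have key : ∀ a b : Fin (l + 2), a - b = 1 → G.Adj (w b) (w a) := by
    intro a b hab
    have hab' : a = b + 1 := by rw [← hab]; abel
    rcases Nat.lt_or_ge ((b : ℕ) + 1) (l + 2) with h | h
    · have : ((b + 1 : Fin (l + 2)) : ℕ) = b + 1 := by
        rw [Fin.val_add_one_of_lt']; exact h
      rw [hab', this]; exact hw _ h
    · have hb : b = Fin.last (l + 1) := by ext; simp; omega
      rw [hab', hb, Fin.last_add_one]; simpa using hw'
  refine hfree.false ⟨fun i => w i, ?_⟩
  intro a b hab
  rw [SimpleGraph.cycleGraph_adj] at hab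
  rcases hab with h | h
  · exact (key a b h).symm
  · exact key b a h

/-- A homomorphic image of a cycle is a closed walk. -/
lemma exists_closedWalk_of_not_homFree {V : Type} {G : SimpleGraph V} {ℓ : ℕ} (hl : 2 ≤ ℓ)
    (h : ¬ HomFree (SimpleGraph.cycleGraph ℓ) G) :
    ∃ v : ℕ → V, (∀ i, i + 1 < ℓ → G.Adj (v i) (v (i + 1))) ∧ G.Adj (v (ℓ - 1)) (v 0) := by
  obtain ⟨l, rfl⟩ : ∃ l, ℓ = l + 2 := ⟨ℓ - 2, by omega⟩
  rw [HomFree, not_isEmpty_iff] at h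
  obtain ⟨φ⟩ := h
  refine ⟨fun i => φ (Fin.ofNat (l + 2) i), ?_, ?_⟩
  · intro i hi
    apply φ.map_adj
    rw [SimpleGraph.cycleGraph_adj]
    right
    rw [sub_eq_iff_eq_add]
    ext
    simp [Fin.val_add, add_comm]
  · apply φ.map_adj
    rw [SimpleGraph.cycleGraph_adj]
    right
    rw [sub_eq_iff_eq_add]
    ext
    simp [add_comm]

lemma homFree_cycleGraph_of_le {V : Type} {G : SimpleGraph V} {k ℓ : ℕ} (hk : 2 ≤ k)
    (hkl : k ≤ ℓ) (hpar : Even (ℓ - k)) (h : HomFree (SimpleGraph.cycleGraph ℓ) G) :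
    HomFree (SimpleGraph.cycleGraph k) G := by
  by_contra hc
  obtain ⟨v, hv, hv'⟩ := exists_closedWalk_of_not_homFree hk hc
  exact not_homFree_cycleGraph_of_closedWalk hk hkl hpar v hv hv' h

lemma homFree_triangle_iff {V : Type} {G : SimpleGraph V} :
    HomFree (SimpleGraph.completeGraph (Fin 3)) G ↔
      ∀ a b c, G.Adj a b → G.Adj b c → G.Adj c a → False := by
  constructor
  · intro h a b c hab hbc hca
    refine h.false ⟨![a, b, c], ?_⟩
    intro i j hij
    have hij' : i ≠ j := hij
    fin_cases i <;> fin_cases j <;>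
      simp_all [hab.symm, hbc.symm, hca.symm]
  · intro h
    refine ⟨fun φ => h (φ 0) (φ 1) (φ 2) ?_ ?_ ?_⟩ <;> exact φ.map_adj (by simp [SimpleGraph.completeGraph])

lemma closedWalk_three_false {V : Type} {G : SimpleGraph V} {ℓ : ℕ} (hl : 3 ≤ ℓ) (ho : Odd ℓ)
    (h : HomFree (SimpleGraph.cycleGraph ℓ) G) (a b c : V) (hab : G.Adj a b) (hbc : G.Adj b c)
    (hca : G.Adj c a) : False := by
  refine not_homFree_cycleGraph_of_closedWalk (k := 3) (by norm_num) hl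
    (Nat.Odd.sub_odd ho (by decide)) (fun i => if i = 0 then a else if i = 1 then b else c)
    ?_ (by simpa using hca) h
  intro i hi
  have : i = 0 ∨ i = 1 := by omega
  rcases this with rfl | rfl <;> simpa

lemma homFree_cycleGraph_three_iff {V : Type} {G : SimpleGraph V} :
    HomFree (SimpleGraph.cycleGraph 3) G ↔
      ∀ a b c, G.Adj a b → G.Adj b c → G.Adj c a → False := by
  constructor
  · intro h a b c
    exact closedWalk_three_false le_rfl (by decide) h a b c
  · intro h
    by_contra hc
    obtain ⟨v, hv, hv'⟩ := exists_closedWalk_of_not_homFree (by norm_num) hc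
    exact h _ _ _ (hv 0 (by norm_num)) (hv 1 (by norm_num)) hv'

/-! ### Monotonicity of the size bound -/

lemma IsSizeBound.mono_epsilon {U U' : Type} {F : SimpleGraph U} {H : SimpleGraph U'} {ε ε' : ℝ}
    {M : ℕ} (hε : ε ≤ ε') (h : IsSizeBound F H ε M) : IsSizeBound F H ε' M := by
  intro V _ G hG
  obtain ⟨W, hW, Γ, f, h1, h2, h3⟩ := h V G hG
  refine ⟨W, hW, Γ, f, h1, h2, h3.trans ?_⟩
  gcongr

lemma IsSizeBound.mono_cycle {U : Type} {F : SimpleGraph U} {k ℓ : ℕ} (hk : 2 ≤ k)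
    (hkl : k ≤ ℓ) (hpar : Even (ℓ - k)) {ε : ℝ} {M : ℕ}
    (h : IsSizeBound F (SimpleGraph.cycleGraph k) ε M) :
    IsSizeBound F (SimpleGraph.cycleGraph ℓ) ε M :=
  fun V _ G hG => h V G (homFree_cycleGraph_of_le hk hkl hpar hG)

/-- Edges of `G` are unordered, so at most half as many are lost as there are ordered pairs. -/
lemma isApproxHom_of_pairs {V W : Type} [Fintype V] {ε : ℝ} {G : SimpleGraph V}
    {Γ : SimpleGraph W} {f : V → W}
    (h : (({p : V × V | G.Adj p.1 p.2 ∧ ¬ Γ.Adj (f p.1) (f p.2)}.ncard : ℕ) : ℝ)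
      ≤ 2 * (ε * (Fintype.card V : ℝ) ^ 2)) : IsApproxHom ε G Γ f := by
  classical
  set E : Set (Sym2 V) := {e ∈ G.edgeSet | Sym2.map f e ∉ Γ.edgeSet} with hE
  set S : Set (V × V) := {p : V × V | G.Adj p.1 p.2 ∧ ¬ Γ.Adj (f p.1) (f p.2)} with hS
  have key : 2 * E.ncard ≤ S.ncard := by
    rw [Set.ncard_eq_toFinset_card' S, Set.ncard_eq_toFinset_card' E]
    have hmap : ∀ p ∈ S.toFinset, Sym2.mk p.1 p.2 ∈ E.toFinset := by
      intro p hp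
      simpa [hE, hS] using hp
    rw [Finset.card_eq_sum_card_fiberwise hmap, mul_comm, ← smul_eq_mul, ← Finset.sum_const]
    refine Finset.sum_le_sum fun e he => ?_
    induction e with
    | _ a b =>
      have hab : G.Adj a b ∧ ¬ Γ.Adj (f a) (f b) := by simpa [hE] using he
      have hne : (a, b) ≠ (b, a) := by
        intro h; exact hab.1.ne (Prod.ext_iff.1 h).1
      rw [← Finset.card_pair hne]
      refine Finset.card_le_card ?_
      intro p hp
      simp only [Finset.mem_insert, Finset.mem_singleton] at hp
      rcases hp with rfl | rfl
      · simpa [hS] using hab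
      · simp only [hS, Finset.mem_filter, Set.mem_toFinset, Set.mem_ofPred_eq]
        exact ⟨⟨hab.1.symm, fun h => hab.2 h.symm⟩, Sym2.eq_swap⟩
  have key' : (2 : ℝ) * (E.ncard : ℝ) ≤ (S.ncard : ℝ) := by exact_mod_cast key
  unfold IsApproxHom
  linarith

/-! ### Existence of the minimum -/

/-- The triangle-free lemma: the parts of a Szemerédi partition, joined when the pair is uniform and
not sparse, form a triangle-free graph by the triangle counting lemma. -/
lemma exists_isSizeBound_triangle {ε : ℝ} (hε : 0 < ε) : ∃ M,
    IsSizeBound (SimpleGraph.completeGraph (Fin 3)) (SimpleGraph.cycleGraph 3) ε M := by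
  classical
  wlog hε1 : ε ≤ 1 generalizing ε
  · obtain ⟨M, hM⟩ := this one_pos le_rfl
    exact ⟨M, hM.mono_epsilon (not_le.1 hε1).le⟩
  refine ⟨⌈4 / ε⌉₊ + SzemerediRegularity.bound (ε / 8) ⌈4 / ε⌉₊, ?_⟩
  intro V _ G hG
  rw [homFree_cycleGraph_three_iff] at hG
  rcases le_or_gt (Fintype.card V) ⌈4 / ε⌉₊ with hV | hV
  · refine ⟨V, inferInstance, G, id, by omega, homFree_triangle_iff.2 hG, ?_⟩
    have : {e ∈ G.edgeSet | Sym2.map id e ∉ G.edgeSet} = ∅ := by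
      ext e; simp
    rw [IsApproxHom, this]
    simp; positivity
  obtain ⟨P, hP₁, hP₂, hP₃, hP₄⟩ :=
    szemeredi_regularity G (by positivity : 0 < ε / 8) hV.le
  have hne : Nonempty V := Fintype.card_pos_iff.1 (by omega)
  have hPε : 4 / ε ≤ P.parts.card := (Nat.le_ceil (4 / ε)).trans (Nat.cast_le.2 hP₂)
  have hcount := SimpleGraph.regularityReduced_edges_card_aux hε hP₁ hP₄ hPε
  let Γ : SimpleGraph P.parts :=
    { Adj := fun A B => A ≠ B ∧ G.IsUniform (ε / 8) (A : Finset V) B ∧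
        ε / 4 ≤ G.edgeDensity (A : Finset V) B
      symm := ⟨fun A B h => ⟨h.1.symm, h.2.1.symm, by rw [G.edgeDensity_comm]; exact h.2.2⟩⟩
      loopless := ⟨fun A h => h.1 rfl⟩ }
  let f : V → P.parts := fun v => ⟨P.part v, P.part_mem.2 (Finset.mem_univ v)⟩
  refine ⟨P.parts, inferInstance, Γ, f, ?_, ?_, ?_⟩
  · rw [Fintype.card_coe]; omega
  · rw [homFree_triangle_iff]
    rintro ⟨A, hA⟩ ⟨B, hB⟩ ⟨C, hC⟩ ⟨-, uAB, dAB⟩ ⟨-, uBC, dBC⟩ ⟨-, uCA, dCA⟩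
    have h2 : 2 * (ε / 8) = ε / 4 := by ring
    have := G.triangle_counting' (s := A) (t := B) (u := C) (ε := ε / 8) (by rw [h2]; exact dAB) uAB
      (by rw [h2, G.edgeDensity_comm]; exact dCA) uCA.symm (by rw [h2]; exact dBC) uBC
    have hempty : (A ×ˢ B ×ˢ C).filter (fun (a, b, c) ↦ G.Adj a b ∧ G.Adj a c ∧ G.Adj b c) = ∅ := by
      rw [Finset.filter_eq_empty_iff]
      rintro ⟨a, b, c⟩ - ⟨hab, hac, hbc⟩
      exact hG a b c hab hbc hac.symm
    rw [hempty, Finset.card_empty, Nat.cast_zero] at this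
    have hA' := Finset.card_pos.2 (P.nonempty_of_mem_parts hA)
    have hB' := Finset.card_pos.2 (P.nonempty_of_mem_parts hB)
    have hC' := Finset.card_pos.2 (P.nonempty_of_mem_parts hC)
    have h1 : 0 < 1 - 2 * (ε / 8) := by linarith
    have : 0 < (1 - 2 * (ε / 8)) * (ε / 8) ^ 3 * (A.card : ℝ) * B.card * C.card := by positivity
    linarith
  · apply isApproxHom_of_pairs
    have hsub : {p : V × V | G.Adj p.1 p.2 ∧ ¬ Γ.Adj (f p.1) (f p.2)} ⊆
        {p : V × V | G.Adj p.1 p.2 ∧ ¬ (G.regularityReduced P (ε / 8) (ε / 4)).Adj p.1 p.2} := by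
      rintro ⟨x, y⟩ ⟨hxy, hn⟩
      refine ⟨hxy, fun h => hn ?_⟩
      obtain ⟨-, A, hA, B, hB, hx, hy, hAB, hu, hd⟩ := h
      have hfx : P.part x = A := (P.part_eq_iff_mem hA).2 hx
      have hfy : P.part y = B := (P.part_eq_iff_mem hB).2 hy
      refine ⟨fun h => hAB ?_, ?_, ?_⟩
      · have := congrArg Subtype.val h
        simpa [f, hfx, hfy] using this
      · simpa [f, hfx, hfy] using hu
      · simpa [f, hfx, hfy] using hd
    have hle := Set.ncard_le_ncard hsub (Set.toFinite _)
    have heq : (({p : V × V | G.Adj p.1 p.2 ∧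
        ¬ (G.regularityReduced P (ε / 8) (ε / 4)).Adj p.1 p.2}.ncard : ℕ) : ℝ) =
        2 * (G.edgeFinset.card - (G.regularityReduced P (ε / 8) (ε / 4)).edgeFinset.card : ℝ) := by
      rw [Set.ncard_eq_toFinset_card']
      have : ({p : V × V | G.Adj p.1 p.2 ∧
        ¬ (G.regularityReduced P (ε / 8) (ε / 4)).Adj p.1 p.2} : Set (V × V)).toFinset =
        (Finset.univ.filter fun (p : V × V) => G.Adj p.1 p.2 ∧
          ¬ (G.regularityReduced P (ε / 8) (ε / 4)).Adj p.1 p.2) := by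
        ext; simp
      rw [this, Finset.filter_and_not, mul_sub, Finset.cast_card_sdiff]
      · norm_cast
        rw [SimpleGraph.two_mul_card_edgeFinset, SimpleGraph.two_mul_card_edgeFinset]
      · intro p
        simp only [Finset.mem_filter]
        exact fun h => ⟨h.1, SimpleGraph.regularityReduced_le h.2⟩
    have hle' : ((({p : V × V | G.Adj p.1 p.2 ∧ ¬ Γ.Adj (f p.1) (f p.2)}.ncard : ℕ) : ℝ)) ≤ _ :=
      Nat.cast_le.2 hle
    rw [heq] at hle'
    push_cast at hcount
    linarith

lemma exists_isSizeBound_cycle {ℓ : ℕ} (hl : 3 ≤ ℓ) (ho : Odd ℓ) {ε : ℝ} (hε : 0 < ε) :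
    ∃ M, IsSizeBound (SimpleGraph.completeGraph (Fin 3)) (SimpleGraph.cycleGraph ℓ) ε M := by
  obtain ⟨M, hM⟩ := exists_isSizeBound_triangle hε
  exact ⟨M, hM.mono_cycle (by norm_num) hl (Nat.Odd.sub_odd ho (by decide))⟩

lemma isLeast_triangleCycleSize {ℓ : ℕ} (hl : 3 ≤ ℓ) (ho : Odd ℓ) {ε : ℝ} (hε : 0 < ε) :
    IsLeast {M : ℕ | IsSizeBound (SimpleGraph.completeGraph (Fin 3))
      (SimpleGraph.cycleGraph ℓ) ε M} (triangleCycleSize ℓ ε) :=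
  ⟨Nat.sInf_mem (exists_isSizeBound_cycle hl ho hε), fun _ h => Nat.sInf_le h⟩

lemma triangleCycleSize_le_of_le {k ℓ : ℕ} (hk : 3 ≤ k) (hkl : k ≤ ℓ) (hko : Odd k) (hlo : Odd ℓ)
    {ε : ℝ} (hε : 0 < ε) : triangleCycleSize ℓ ε ≤ triangleCycleSize k ε :=
  (isLeast_triangleCycleSize (hk.trans hkl) hlo hε).2
    (IsSizeBound.mono_cycle (by omega) hkl (Nat.Odd.sub_odd hlo hko)
      (isLeast_triangleCycleSize hk hko hε).1)

/-! ### A linear upper bound for long cycles -/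

/-- A small set `S` of vertices whose neighbourhoods cover all but at most `t` of the neighbours of
every vertex: take a largest `S` that covers at least `S.card * t` vertices. -/
lemma exists_dominating_set {V : Type} [Fintype V] [DecidableEq V] (G : SimpleGraph V)
    [DecidableRel G.Adj] {t : ℝ} (ht : 0 ≤ t) :
    ∃ S : Finset V, S.card * t ≤ Fintype.card V ∧
      ∀ w, ((Finset.univ.filter fun u => G.Adj w u ∧ ∀ x ∈ S, ¬ G.Adj x u).card : ℝ) ≤ t := by
  let cov : Finset V → Finset V := fun S => Finset.univ.filter fun u => ∃ x ∈ S, G.Adj x u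
  let fam : Finset (Finset V) := Finset.univ.filter fun S => S.card * t ≤ (cov S).card
  obtain ⟨S, hS, hmax⟩ := fam.exists_max_image Finset.card ⟨∅, by simp [fam, cov]⟩
  have hSc : S.card * t ≤ (cov S).card := by simpa [fam] using hS
  refine ⟨S, hSc.trans (by exact_mod_cast Finset.card_le_univ _), fun w => ?_⟩
  by_contra! hw
  set N := Finset.univ.filter fun u => G.Adj w u ∧ ∀ x ∈ S, ¬ G.Adj x u with hN
  have hwS : w ∉ S := by
    intro hwS
    have : N = ∅ := by
      rw [hN, Finset.filter_eq_empty_iff]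
      exact fun u _ h => h.2 w hwS h.1
    rw [this, Finset.card_empty, Nat.cast_zero] at hw
    linarith
  have hdisj : Disjoint (cov S) N := by
    rw [Finset.disjoint_left]
    intro u hu hu'
    simp only [cov, hN, Finset.mem_filter, Finset.mem_univ, true_and] at hu hu'
    obtain ⟨x, hx, hxu⟩ := hu
    exact hu'.2 x hx hxu
  have hsub : cov S ∪ N ⊆ cov (insert w S) := by
    intro u hu
    simp only [cov, hN, Finset.mem_union, Finset.mem_filter, Finset.mem_univ, true_and] at hu ⊢
    rcases hu with ⟨x, hx, hxu⟩ | ⟨hwu, -⟩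
    · exact ⟨x, Finset.mem_insert_of_mem hx, hxu⟩
    · exact ⟨w, Finset.mem_insert_self _ _, hwu⟩
  have hcard := Finset.card_le_card hsub
  rw [Finset.card_union_of_disjoint hdisj] at hcard
  have hcard' : ((cov S).card : ℝ) + N.card ≤ (cov (insert w S)).card := by exact_mod_cast hcard
  have hins := Finset.card_insert_of_notMem hwS
  have := hmax (insert w S) (by
    simp only [fam, Finset.mem_filter, Finset.mem_univ, true_and]
    rw [hins]
    push_cast
    linarith)
  omega

/-- Send every covered vertex to one of its neighbours in a small dominating set. Two vertices with
the same image are joined by a walk of length two, so a triangle in the image would lift to a closed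
walk of length nine. -/
lemma isSizeBound_of_nine_le {ℓ : ℕ} (hl : 9 ≤ ℓ) (ho : Odd ℓ) {ε : ℝ} (hε : 0 < ε) (hε1 : ε ≤ 1) :
    IsSizeBound (SimpleGraph.completeGraph (Fin 3)) (SimpleGraph.cycleGraph ℓ) ε ⌊2 / ε⌋₊ := by
  classical
  intro V _ G hG
  set n : ℝ := (Fintype.card V : ℝ) with hn
  have hn0 : 0 ≤ n := by positivity
  obtain ⟨S, hS, hSw⟩ := exists_dominating_set G (t := ε * n) (by positivity)
  let f : V → Option S := fun u =>
    if h : ∃ x ∈ S, G.Adj x u then some ⟨h.choose, h.choose_spec.1⟩ else none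
  have hf : ∀ u x, f u = some x → G.Adj x u := by
    intro u x hux
    by_cases h : ∃ x ∈ S, G.Adj x u
    · simp only [f, dif_pos h, Option.some.injEq] at hux
      rw [← hux]; exact h.choose_spec.2
    · simp [f, dif_neg h] at hux
  have hf' : ∀ u, f u = none → ∀ x ∈ S, ¬ G.Adj x u := by
    intro u hu x hx hxu
    have h : ∃ x ∈ S, G.Adj x u := ⟨x, hx, hxu⟩
    simp [f, dif_pos h] at hu
  let Γ : SimpleGraph (Option S) :=
    { Adj := fun a b => a ≠ b ∧ a ≠ none ∧ b ≠ none ∧ ∃ u v, G.Adj u v ∧ f u = a ∧ f v = b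
      symm := ⟨fun a b ⟨h1, h2, h3, u, v, h4, h5, h6⟩ => ⟨h1.symm, h3, h2, v, u, h4.symm, h6, h5⟩⟩
      loopless := ⟨fun a h => h.1 rfl⟩ }
  refine ⟨Option S, inferInstance, Γ, f, ?_, ?_, ?_⟩
  · apply Nat.le_floor
    rw [Fintype.card_option, Fintype.card_coe]
    have h1 : (1 : ℝ) ≤ 1 / ε := by rw [le_div_iff₀ hε]; linarith
    have h2 : (S.card : ℝ) ≤ 1 / ε := by
      rcases hn0.eq_or_lt with h0 | h0
      · have : Fintype.card V = 0 := by
          have h := h0.symm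
          rw [hn] at h
          exact_mod_cast h
        have : S.card = 0 := by have := S.card_le_univ; omega
        rw [this]; push_cast; linarith
      · rw [le_div_iff₀ hε]
        refine le_of_mul_le_mul_right ?_ h0
        linarith
    push_cast
    have : 2 / ε = 1 / ε + 1 / ε := by ring
    linarith
  · rw [homFree_triangle_iff]
    rintro a b c ⟨-, ha, hb, u₁, u₂, h12, rfl, rfl⟩ ⟨-, -, hc, v₂, u₃, h23, hv₂, rfl⟩
      ⟨-, -, -, v₃, v₁, h31, hv₃, hv₁⟩
    obtain ⟨a, ha⟩ := Option.ne_none_iff_exists'.1 ha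
    obtain ⟨b, hb⟩ := Option.ne_none_iff_exists'.1 hb
    obtain ⟨c, hc⟩ := Option.ne_none_iff_exists'.1 hc
    rw [hb] at hv₂
    rw [hc] at hv₃
    rw [ha] at hv₁
    refine not_homFree_cycleGraph_of_closedWalk (k := 9) (by norm_num) hl
      (Nat.Odd.sub_odd ho (by decide))
      (fun i => [(a : V), u₁, u₂, b, v₂, u₃, c, v₃, v₁].getD i a) ?_ ?_ hG
    · intro i hi
      have : i < 8 := by omega
      interval_cases i
      · exact hf _ _ ha
      · exact h12
      · exact (hf _ _ hb).symm
      · exact hf _ _ hv₂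
      · exact h23
      · exact (hf _ _ hc).symm
      · exact hf _ _ hv₃
      · exact h31
    · exact (hf _ _ hv₁).symm
  · apply isApproxHom_of_pairs
    let N : V → Finset V := fun w => Finset.univ.filter fun u => G.Adj w u ∧ ∀ x ∈ S, ¬ G.Adj x u
    let Q : Finset (V × V) := (Finset.univ : Finset V).sigma N |>.image fun p => (p.1, p.2)
    have hQ : (Q.card : ℝ) ≤ n * (ε * n) := by
      have h1 : Q.card ≤ ∑ w, (N w).card :=
        Finset.card_image_le.trans (Finset.card_sigma _ _).le
      have h2 : (Q.card : ℝ) ≤ ∑ w, ((N w).card : ℝ) := by exact_mod_cast h1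
      refine h2.trans ((Finset.sum_le_sum fun w _ => hSw w).trans ?_)
      rw [Finset.sum_const, nsmul_eq_mul, Finset.card_univ]
    have hmem : ∀ w u, G.Adj w u → f u = none → (w, u) ∈ Q := by
      intro w u hwu hu
      refine Finset.mem_image.2 ⟨⟨w, u⟩, ?_, rfl⟩
      simpa [N] using ⟨hwu, hf' u hu⟩
    have hsub : {p : V × V | G.Adj p.1 p.2 ∧ ¬ Γ.Adj (f p.1) (f p.2)} ⊆
        ((Q ∪ Q.image Prod.swap : Finset (V × V)) : Set (V × V)) := by
      rintro ⟨u, v⟩ ⟨huv, hΓ⟩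
      simp only [Finset.coe_union, Set.mem_union, Finset.mem_coe]
      by_cases hv : f v = none
      · exact Or.inl (hmem u v huv hv)
      by_cases hu : f u = none
      · exact Or.inr (Finset.mem_image.2 ⟨(v, u), hmem v u huv.symm hu, rfl⟩)
      exfalso
      refine hΓ ⟨fun he => ?_, hu, hv, u, v, huv, rfl, rfl⟩
      obtain ⟨x, hx⟩ := Option.ne_none_iff_exists'.1 hu
      exact closedWalk_three_false (by omega) ho hG x u v (hf u x hx) huv
        (hf v x (he ▸ hx)).symm
    have hle := Set.ncard_le_ncard hsub (Set.toFinite _)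
    rw [Set.ncard_coe_finset] at hle
    have hle2 := hle.trans ((Finset.card_union_le _ _).trans
      (Nat.add_le_add_left Finset.card_image_le _))
    have hle3 : (({p : V × V | G.Adj p.1 p.2 ∧ ¬ Γ.Adj (f p.1) (f p.2)}.ncard : ℕ) : ℝ)
        ≤ Q.card + Q.card := by exact_mod_cast hle2
    rw [← hn]
    nlinarith

/-- The minimum size for odd cycles of length at least nine is at most linear in `1 / ε`. -/
lemma triangleCycleSize_le_linear {ℓ : ℕ} (hl : 9 ≤ ℓ) (ho : Odd ℓ) {ε : ℝ} (hε : 0 < ε)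
    (hε1 : ε ≤ 1) : (triangleCycleSize ℓ ε : ℝ) ≤ 2 * (1 / ε) := by
  have h := (isLeast_triangleCycleSize (by omega) ho hε).2 (isSizeBound_of_nine_le hl ho hε hε1)
  calc (triangleCycleSize ℓ ε : ℝ) ≤ (⌊2 / ε⌋₊ : ℝ) := by exact_mod_cast h
    _ ≤ 2 / ε := Nat.floor_le (by positivity)
    _ = 2 * (1 / ε) := by ring

/-! ### Averaging over the fibres of a map -/

open scoped Classical in
/-- The average of `F` over the fibre of `g` through `x`. -/
noncomputable def fibreAvg {X Q : Type} [Fintype X] (g : X → Q) (F : X → ℝ) (x : X) : ℝ :=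
  (∑ y with g y = g x, F y) / ((Finset.univ.filter fun y => g y = g x).card : ℝ)

section fibreAvg
variable {X Q : Type} [Fintype X] (g : X → Q) (F : X → ℝ)

lemma fibreAvg_congr {x y : X} (h : g x = g y) : fibreAvg g F x = fibreAvg g F y := by
  unfold fibreAvg
  rw [h]

lemma fibreAvg_nonneg (hF : ∀ x, 0 ≤ F x) (x : X) : 0 ≤ fibreAvg g F x :=
  div_nonneg (Finset.sum_nonneg fun y _ => hF y) (by positivity)

lemma fibreAvg_le_one (hF : ∀ x, F x ≤ 1) (x : X) : fibreAvg g F x ≤ 1 := by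
  refine div_le_one_of_le₀ ?_ (by positivity)
  refine (Finset.sum_le_sum fun y _ => hF y).trans ?_
  simp

/-- Averaging is the orthogonal projection onto the functions that are constant on fibres. -/
lemma sum_fibreAvg_mul (h : X → ℝ) (hh : ∀ x y, g x = g y → h x = h y) :
    ∑ x, fibreAvg g F x * h x = ∑ x, F x * h x := by
  classical
  have h1 : ∀ x, fibreAvg g F x * h x = ∑ y, if g y = g x then
      F y * h y / ((Finset.univ.filter fun z => g z = g y).card : ℝ) else 0 := by
    intro x
    rw [fibreAvg, Finset.sum_div, Finset.sum_mul, Finset.sum_filter]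
    refine Finset.sum_congr (by congr) fun y _ => ?_
    split_ifs with hy
    · rw [hh y x hy, hy]; ring
    · rfl
  simp_rw [h1]
  rw [Finset.sum_comm]
  refine Finset.sum_congr rfl fun y _ => ?_
  rw [← Finset.sum_filter, Finset.sum_const, nsmul_eq_mul]
  have h2 : (Finset.univ.filter fun x => g y = g x) = Finset.univ.filter fun x => g x = g y := by
    ext; simp [eq_comm]
  rw [h2]
  have h3 : ((Finset.univ.filter fun z => g z = g y).card : ℝ) ≠ 0 := by
    have : 0 < (Finset.univ.filter fun z => g z = g y).card :=
      Finset.card_pos.2 ⟨y, by simp⟩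
    positivity
  field_simp

end fibreAvg

/-! ### Weak regularity -/

section regularity
variable {V : Type} [Fintype V]

/-- One step of the energy increment: refining by sets that witness irregularity increases the mean
square of the averaged function. -/
lemma energy_increment {X Q Q' : Type} [Fintype X] {g : X → Q} {g' : X → Q'}
    (hg : ∀ x y, g' x = g' y → g x = g y) (F : X → ℝ) {R : Finset X}
    (hR : ∀ x y, g' x = g' y → (x ∈ R ↔ y ∈ R)) :
    (∑ x ∈ R, (F x - fibreAvg g F x)) ^ 2 ≤ Fintype.card X *
      (∑ x, fibreAvg g' F x ^ 2 - ∑ x, fibreAvg g F x ^ 2) := by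
  classical
  have h1 : ∑ x, fibreAvg g' F x * fibreAvg g F x = ∑ x, fibreAvg g F x ^ 2 := by
    rw [sum_fibreAvg_mul g' F _ fun x y h => fibreAvg_congr g F (hg x y h)]
    rw [← sum_fibreAvg_mul g F _ fun x y h => fibreAvg_congr g F h]
    simp_rw [sq]
  have h2 : ∑ x, (fibreAvg g' F x - fibreAvg g F x) ^ 2 =
      ∑ x, fibreAvg g' F x ^ 2 - ∑ x, fibreAvg g F x ^ 2 := by
    have : ∀ x, (fibreAvg g' F x - fibreAvg g F x) ^ 2 = fibreAvg g' F x ^ 2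
        - 2 * (fibreAvg g' F x * fibreAvg g F x) + fibreAvg g F x ^ 2 := fun x => by ring
    simp_rw [this]
    rw [Finset.sum_add_distrib, Finset.sum_sub_distrib, ← Finset.mul_sum, h1]
    ring
  have h3 : ∑ x ∈ R, (F x - fibreAvg g F x) = ∑ x ∈ R, (fibreAvg g' F x - fibreAvg g F x) := by
    rw [Finset.sum_sub_distrib, Finset.sum_sub_distrib]
    congr 1
    have := sum_fibreAvg_mul g' F (fun x => if x ∈ R then 1 else 0)
      fun x y h => by simp only [hR x y h]
    simpa [mul_ite, Finset.sum_ite_mem] using this.symm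
  rw [h3, ← h2]
  refine sq_sum_le_card_mul_sum_sq.trans ?_
  refine mul_le_mul (by exact_mod_cast Finset.card_le_univ _) ?_
    (Finset.sum_nonneg fun _ _ => sq_nonneg _) (by positivity)
  exact Finset.sum_le_sum_of_subset_of_nonneg (Finset.subset_univ _) fun _ _ _ => sq_nonneg _

/-- Weak (Frieze–Kannan) regularity lemma: some partition into at most `4 ^ K` classes has averages
that approximate `A` in cut norm. -/
lemma exists_weakly_regular_map (A : V × V → ℝ) (hA0 : ∀ p, 0 ≤ A p) (hA1 : ∀ p, A p ≤ 1)
    {δ : ℝ} (hδ : 0 < δ) {K : ℕ} (hK : 1 < K * δ ^ 2) :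
    ∃ (Q : Type) (_ : Fintype Q) (f : V → Q), Fintype.card Q ≤ 4 ^ K ∧
      ∀ S T : Finset V, |∑ p ∈ S ×ˢ T, (A p - fibreAvg (Prod.map f f) A p)|
        ≤ δ * (Fintype.card V : ℝ) ^ 2 := by
  classical
  by_contra! hcon
  set n : ℝ := (Fintype.card V : ℝ) with hn
  have hnpos : 0 < n := by
    obtain ⟨S, T, h⟩ := hcon Unit inferInstance (fun _ => ())
      (by simpa using Nat.one_le_pow _ _ (by norm_num))
    rcases isEmpty_or_nonempty V with hV | hV
    · exfalso
      rw [show S = ∅ from Subsingleton.elim _ _, hn, Fintype.card_eq_zero] at h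
      simp at h
    · rw [hn]; exact_mod_cast Fintype.card_pos
  have hX : (Fintype.card (V × V) : ℝ) = n ^ 2 := by
    rw [Fintype.card_prod]; push_cast; ring
  have step : ∀ k ≤ K, ∃ (Q : Type) (_ : Fintype Q) (f : V → Q), Fintype.card Q ≤ 4 ^ k ∧
      k * (δ ^ 2 * n ^ 2) ≤ ∑ p, fibreAvg (Prod.map f f) A p ^ 2 := by
    intro k
    induction k with
    | zero =>
      intro _
      refine ⟨Unit, inferInstance, fun _ => (), by simp, ?_⟩
      simpa using Finset.sum_nonneg fun p _ => sq_nonneg _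
    | succ k ih =>
      intro hk
      obtain ⟨Q, hQ, f, hcard, hen⟩ := ih (by omega)
      obtain ⟨S, T, hST⟩ := hcon Q hQ f (hcard.trans (Nat.pow_le_pow_right (by norm_num) (by omega)))
      let f' : V → Q × Bool × Bool := fun x => (f x, decide (x ∈ S), decide (x ∈ T))
      refine ⟨Q × Bool × Bool, inferInstance, f', ?_, ?_⟩
      · simp only [Fintype.card_prod, Fintype.card_bool, pow_succ]; omega
      have hf' : ∀ x y, f' x = f' y → f x = f y ∧ (x ∈ S ↔ y ∈ S) ∧ (x ∈ T ↔ y ∈ T) := by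
        intro x y h
        simpa [f', Prod.ext_iff] using h
      have := energy_increment (g := Prod.map f f) (g' := Prod.map f' f') (by
          rintro ⟨x, y⟩ ⟨x', y'⟩ h
          simp only [Prod.map_apply, Prod.mk.injEq] at h ⊢
          exact ⟨(hf' _ _ h.1).1, (hf' _ _ h.2).1⟩) A (R := S ×ˢ T) (by
          rintro ⟨x, y⟩ ⟨x', y'⟩ h
          simp only [Prod.map_apply, Prod.mk.injEq] at h
          simp only [Finset.mem_product]
          rw [(hf' _ _ h.1).2.1, (hf' _ _ h.2).2.2])
      rw [hX, ← sq_abs] at this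
      have h2 : (δ * n ^ 2) ^ 2 ≤ n ^ 2 * (∑ x, fibreAvg (Prod.map f' f') A x ^ 2 -
          ∑ x, fibreAvg (Prod.map f f) A x ^ 2) :=
        (pow_le_pow_left₀ (by positivity) hST.le 2).trans this
      have h3 : n ^ 2 * (δ ^ 2 * n ^ 2) ≤ n ^ 2 * (∑ x, fibreAvg (Prod.map f' f') A x ^ 2 -
          ∑ x, fibreAvg (Prod.map f f) A x ^ 2) := by
        refine le_trans (le_of_eq ?_) h2; ring
      have h4 := le_of_mul_le_mul_left h3 (by positivity)
      push_cast
      linarith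
  obtain ⟨Q, hQ, f, -, hen⟩ := step K le_rfl
  have h1 : ∑ p, fibreAvg (Prod.map f f) A p ^ 2 ≤ n ^ 2 := by
    rw [← hX]
    refine (Finset.sum_le_sum fun p _ => pow_le_one₀ (fibreAvg_nonneg _ _ hA0 p)
      (fibreAvg_le_one _ _ hA1 p)).trans ?_
    simp [Finset.card_univ]
  have h2 : n ^ 2 < K * (δ ^ 2 * n ^ 2) := by
    have : 0 < n ^ 2 := by positivity
    nlinarith
  linarith

/-- A linear form on the cube is bounded by its values at the vertices. -/
lemma abs_sum_mul_le_of_subset {c u : V → ℝ} {K : ℝ} (hu0 : ∀ x, 0 ≤ u x) (hu1 : ∀ x, u x ≤ 1)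
    (h : ∀ S : Finset V, |∑ x ∈ S, c x| ≤ K) : |∑ x, u x * c x| ≤ K := by
  classical
  have hup : ∑ x, u x * c x ≤ ∑ x with 0 ≤ c x, c x := by
    rw [Finset.sum_filter]
    refine Finset.sum_le_sum fun x _ => ?_
    split_ifs with hx
    · nlinarith [hu1 x]
    · nlinarith [hu0 x]
  have hlow : ∑ x with c x ≤ 0, c x ≤ ∑ x, u x * c x := by
    rw [Finset.sum_filter]
    refine Finset.sum_le_sum fun x _ => ?_
    split_ifs with hx
    · nlinarith [hu1 x]
    · nlinarith [hu0 x]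
  rw [abs_le]
  exact ⟨by linarith [(abs_le.1 (h {x | c x ≤ 0})).1], by linarith [(abs_le.1 (h {x | 0 ≤ c x})).2]⟩

lemma abs_bilinear_le_of_cut {D : V × V → ℝ} {u w : V → ℝ} {K : ℝ}
    (hu0 : ∀ x, 0 ≤ u x) (hu1 : ∀ x, u x ≤ 1) (hw0 : ∀ x, 0 ≤ w x) (hw1 : ∀ x, w x ≤ 1)
    (h : ∀ S T : Finset V, |∑ p ∈ S ×ˢ T, D p| ≤ K) :
    |∑ x, ∑ y, D (x, y) * (u x * w y)| ≤ K := by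
  have h1 : ∑ x, ∑ y, D (x, y) * (u x * w y) = ∑ x, u x * ∑ y, D (x, y) * w y := by
    refine Finset.sum_congr rfl fun x _ => ?_
    rw [Finset.mul_sum]
    exact Finset.sum_congr rfl fun y _ => by ring
  rw [h1]
  refine abs_sum_mul_le_of_subset hu0 hu1 fun S => ?_
  have h2 : ∑ x ∈ S, ∑ y, D (x, y) * w y = ∑ y, w y * ∑ x ∈ S, D (x, y) := by
    rw [Finset.sum_comm]
    refine Finset.sum_congr rfl fun x _ => ?_
    rw [Finset.mul_sum]
    exact Finset.sum_congr rfl fun y _ => by ring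
  rw [h2]
  refine abs_sum_mul_le_of_subset hw0 hw1 fun T => ?_
  rw [Finset.sum_comm, ← Finset.sum_product']
  exact h S T

/-! ### Counting pentagons -/

/-- The weighted number of closed walks of length five whose steps are weighted by the five given
kernels. -/
def pentagons (M₁ M₂ M₃ M₄ M₅ : V × V → ℝ) : ℝ :=
  ∑ a, ∑ b, ∑ c, ∑ d, ∑ e, M₁ (a, b) * M₂ (b, c) * M₃ (c, d) * M₄ (d, e) * M₅ (e, a)

lemma pentagons_rotate (M₁ M₂ M₃ M₄ M₅ : V × V → ℝ) :
    pentagons M₁ M₂ M₃ M₄ M₅ = pentagons M₂ M₃ M₄ M₅ M₁ := by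
  unfold pentagons
  rw [Finset.sum_comm]
  refine Finset.sum_congr rfl fun b _ => ?_
  rw [Finset.sum_comm]
  refine Finset.sum_congr rfl fun c _ => ?_
  rw [Finset.sum_comm]
  refine Finset.sum_congr rfl fun d _ => ?_
  rw [Finset.sum_comm]
  refine Finset.sum_congr rfl fun e _ => Finset.sum_congr rfl fun a _ => ?_
  ring

/-- Replacing one kernel by another that is close in cut norm changes little. -/
lemma abs_pentagons_sub_le {M M' M₂ M₃ M₄ M₅ : V × V → ℝ} {K : ℝ}
    (h : ∀ S T : Finset V, |∑ p ∈ S ×ˢ T, (M p - M' p)| ≤ K)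
    (h2 : ∀ p, 0 ≤ M₂ p ∧ M₂ p ≤ 1) (h3 : ∀ p, 0 ≤ M₃ p ∧ M₃ p ≤ 1)
    (h4 : ∀ p, 0 ≤ M₄ p ∧ M₄ p ≤ 1) (h5 : ∀ p, 0 ≤ M₅ p ∧ M₅ p ≤ 1) :
    |pentagons M M₂ M₃ M₄ M₅ - pentagons M' M₂ M₃ M₄ M₅| ≤ (Fintype.card V : ℝ) ^ 3 * K := by
  have key : ∀ N : V × V → ℝ, pentagons N M₂ M₃ M₄ M₅ = ∑ c, ∑ d, ∑ e, ∑ a, ∑ b,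
      N (a, b) * (M₅ (e, a) * (M₂ (b, c) * M₃ (c, d) * M₄ (d, e))) := by
    intro N
    rw [pentagons_rotate, pentagons_rotate]
    unfold pentagons
    refine Finset.sum_congr rfl fun c _ => Finset.sum_congr rfl fun d _ =>
      Finset.sum_congr rfl fun e _ => Finset.sum_congr rfl fun a _ =>
      Finset.sum_congr rfl fun b _ => ?_
    ring
  rw [key, key]
  simp_rw [← Finset.sum_sub_distrib, ← sub_mul]
  have hb : ∀ c d e, |∑ a, ∑ b, (M (a, b) - M' (a, b)) *
      (M₅ (e, a) * (M₂ (b, c) * M₃ (c, d) * M₄ (d, e)))| ≤ K := by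
    intro c d e
    refine abs_bilinear_le_of_cut (D := fun p => M p - M' p) (u := fun a => M₅ (e, a))
      (w := fun b => M₂ (b, c) * M₃ (c, d) * M₄ (d, e)) (fun a => (h5 _).1) (fun a => (h5 _).2)
      (fun b => mul_nonneg (mul_nonneg (h2 _).1 (h3 _).1) (h4 _).1) (fun b => ?_) h
    exact mul_le_one₀ (mul_le_one₀ (h2 _).2 (h3 _).1 (h3 _).2) (h4 _).1 (h4 _).2
  calc _ ≤ ∑ c : V, ∑ d : V, ∑ e : V, K := by
        refine (Finset.abs_sum_le_sum_abs _ _).trans (Finset.sum_le_sum fun c _ => ?_)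
        refine (Finset.abs_sum_le_sum_abs _ _).trans (Finset.sum_le_sum fun d _ => ?_)
        exact (Finset.abs_sum_le_sum_abs _ _).trans (Finset.sum_le_sum fun e _ => hb c d e)
    _ = _ := by
        simp only [Finset.sum_const, nsmul_eq_mul, Finset.card_univ]; ring

lemma pentagons_le_add {A B : V × V → ℝ} {K : ℝ}
    (h : ∀ S T : Finset V, |∑ p ∈ S ×ˢ T, (A p - B p)| ≤ K)
    (hA : ∀ p, 0 ≤ A p ∧ A p ≤ 1) (hB : ∀ p, 0 ≤ B p ∧ B p ≤ 1) :
    pentagons B B B B B ≤ pentagons A A A A A + 5 * ((Fintype.card V : ℝ) ^ 3 * K) := by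
  have h1 := (abs_le.1 (abs_pentagons_sub_le h hB hB hB hB)).1
  have h2 := (abs_le.1 (abs_pentagons_sub_le h hB hB hB hA)).1
  have h3 := (abs_le.1 (abs_pentagons_sub_le h hB hB hA hA)).1
  have h4 := (abs_le.1 (abs_pentagons_sub_le h hB hA hA hA)).1
  have h5 := (abs_le.1 (abs_pentagons_sub_le h hA hA hA hA)).1
  rw [pentagons_rotate A B B B B] at h1
  rw [pentagons_rotate A B B B A] at h2
  rw [pentagons_rotate A B B A A] at h3
  rw [pentagons_rotate A B A A A] at h4
  linarith

end regularity

/-! ### Fractional triangle packings contain many pentagons -/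

section packing
variable {V : Type} [Fintype V]

/-- A fractional packing of triangles in the weighted graph `W`: weights on ordered triples such that
every ordered pair carries, in each of the three positions, at most its weight in `W`. -/
structure IsTrianglePacking (W : V × V → ℝ) (τ : V × V × V → ℝ) : Prop where
  nonneg : ∀ t, 0 ≤ τ t
  fst_snd : ∀ x y, ∑ z, τ (x, y, z) ≤ W (x, y)
  fst_thd : ∀ x z, ∑ y, τ (x, y, z) ≤ W (x, z)
  snd_thd : ∀ y z, ∑ x, τ (x, y, z) ≤ W (y, z)

/-- Sidorenko's inequality for the four-cycle: two applications of Cauchy–Schwarz. -/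
lemma pow_four_sum_le (w : V × V → ℝ) :
    (∑ x, ∑ y, w (x, y)) ^ 4 ≤ (Fintype.card V : ℝ) ^ 4 *
      ∑ x, ∑ y, ∑ v, ∑ a, w (x, y) * (w (x, a) * w (v, a) * w (v, y)) := by
  set n : ℝ := (Fintype.card V : ℝ) with hn
  have h1 : (∑ x, ∑ y, w (x, y)) ^ 2 ≤ n * ∑ y, ∑ a, ∑ x, w (x, y) * w (x, a) := by
    have := sq_sum_le_card_mul_sum_sq (s := (Finset.univ : Finset V))
      (f := fun x => ∑ y, w (x, y))
    rw [Finset.card_univ] at this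
    refine this.trans (le_of_eq ?_)
    congr 1
    simp_rw [sq, Finset.sum_mul_sum]
    rw [Finset.sum_comm]
    exact Finset.sum_congr rfl fun y _ => Finset.sum_comm
  have h2 : (∑ y, ∑ a, ∑ x, w (x, y) * w (x, a)) ^ 2 ≤
      n ^ 2 * ∑ y, ∑ a, (∑ x, w (x, y) * w (x, a)) ^ 2 := by
    have := sq_sum_le_card_mul_sum_sq (s := (Finset.univ : Finset (V × V)))
      (f := fun p => ∑ x, w (x, p.1) * w (x, p.2))
    rw [Finset.card_univ, Fintype.card_prod, Fintype.sum_prod_type, Fintype.sum_prod_type] at this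
    refine this.trans (le_of_eq ?_)
    push_cast
    ring
  have h3 : ∑ y, ∑ a, (∑ x, w (x, y) * w (x, a)) ^ 2 =
      ∑ x, ∑ y, ∑ v, ∑ a, w (x, y) * (w (x, a) * w (v, a) * w (v, y)) := by
    simp_rw [sq, Finset.sum_mul_sum]
    have : ∀ y, ∑ a, ∑ x, ∑ v, w (x, y) * w (x, a) * (w (v, y) * w (v, a)) =
        ∑ x, ∑ v, ∑ a, w (x, y) * (w (x, a) * w (v, a) * w (v, y)) := by
      intro y
      rw [Finset.sum_comm]
      refine Finset.sum_congr rfl fun x _ => ?_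
      rw [Finset.sum_comm]
      refine Finset.sum_congr rfl fun v _ => Finset.sum_congr rfl fun a _ => ?_
      ring
    simp_rw [this]
    rw [Finset.sum_comm]
  rw [← h3]
  have h0 : 0 ≤ (∑ x, ∑ y, w (x, y)) ^ 2 := sq_nonneg _
  calc (∑ x, ∑ y, w (x, y)) ^ 4 = ((∑ x, ∑ y, w (x, y)) ^ 2) ^ 2 := by ring
    _ ≤ (n * ∑ y, ∑ a, ∑ x, w (x, y) * w (x, a)) ^ 2 := pow_le_pow_left₀ h0 h1 2
    _ = n ^ 2 * (∑ y, ∑ a, ∑ x, w (x, y) * w (x, a)) ^ 2 := by ring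
    _ ≤ n ^ 2 * (n ^ 2 * ∑ y, ∑ a, (∑ x, w (x, y) * w (x, a)) ^ 2) := by gcongr
    _ = _ := by ring

/-- The asymmetric counting inequality. By Sidorenko's inequality a packed triangle `x y z` has on
average many walks of length three from `x` to `y`; for a fixed third vertex `z` the packing is a
fractional matching in the neighbourhood of `z`, and Cauchy–Schwarz converts the walks between matched
pairs into walks between arbitrary pairs of neighbours of `z`, that is, into pentagons. -/
lemma IsTrianglePacking.pow_eight_le {W : V × V → ℝ} {τ : V × V × V → ℝ}
    (hτ : IsTrianglePacking W τ) (hW0 : ∀ p, 0 ≤ W p) (hW1 : ∀ p, W p ≤ 1)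
    (hWs : ∀ x y, W (x, y) = W (y, x)) :
    (∑ x, ∑ y, ∑ z, τ (x, y, z)) ^ 8 ≤ (Fintype.card V : ℝ) ^ 11 * pentagons W W W W W := by
  set n : ℝ := (Fintype.card V : ℝ) with hn
  -- `K` and `L` count the walks of length two and three.
  let K : V → V → ℝ := fun x v => ∑ a, W (x, a) * W (a, v)
  let L : V → V → ℝ := fun z v => ∑ x, W (z, x) * K x v
  have hK0 : ∀ x v, 0 ≤ K x v := fun x v =>
    Finset.sum_nonneg fun a _ => mul_nonneg (hW0 _) (hW0 _)
  have hKn : ∀ x v, K x v ≤ n := fun x v => by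
    refine (Finset.sum_le_sum fun a _ => mul_le_one₀ (hW1 _) (hW0 _) (hW1 _)).trans ?_
    simp [hn]
  let P : V → V → ℝ := fun z v => ∑ x, ∑ y, τ (x, y, z) * (K x v * W (v, y))
  have hP0 : ∀ z v, 0 ≤ P z v := fun z v => Finset.sum_nonneg fun x _ =>
    Finset.sum_nonneg fun y _ => mul_nonneg (hτ.nonneg _) (mul_nonneg (hK0 _ _) (hW0 _))
  have h1 : (∑ x, ∑ y, ∑ z, τ (x, y, z)) ^ 4 ≤ n ^ 4 * ∑ z, ∑ v, P z v := by
    have := pow_four_sum_le (fun p : V × V => ∑ z, τ (p.1, p.2, z))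
    refine this.trans (mul_le_mul_of_nonneg_left ?_ (by positivity))
    have h2 : ∑ z, ∑ v, P z v = ∑ x, ∑ y, ∑ v, ∑ a, (∑ z, τ (x, y, z)) *
        (W (x, a) * W (v, a) * W (v, y)) := by
      have e1 : ∀ x y v, ∑ a, (∑ z, τ (x, y, z)) * (W (x, a) * W (v, a) * W (v, y)) =
          ∑ z, τ (x, y, z) * (K x v * W (v, y)) := by
        intro x y v
        rw [← Finset.mul_sum, ← Finset.sum_mul, Finset.sum_mul]
        refine Finset.sum_congr rfl fun z _ => ?_
        simp only [K]
        congr 2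
        exact Finset.sum_congr rfl fun a _ => by rw [hWs v a]
      simp_rw [e1]
      simp only [P]
      calc ∑ z, ∑ v, ∑ x, ∑ y, τ (x, y, z) * (K x v * W (v, y))
          = ∑ z, ∑ x, ∑ y, ∑ v, τ (x, y, z) * (K x v * W (v, y)) := by
            refine Finset.sum_congr rfl fun z _ => ?_
            rw [Finset.sum_comm]
            exact Finset.sum_congr rfl fun x _ => Finset.sum_comm
        _ = ∑ x, ∑ y, ∑ v, ∑ z, τ (x, y, z) * (K x v * W (v, y)) := by
            rw [Finset.sum_comm]
            refine Finset.sum_congr rfl fun x _ => ?_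
            rw [Finset.sum_comm]
            exact Finset.sum_congr rfl fun y _ => Finset.sum_comm
    rw [h2]
    have hw0 : ∀ x y, 0 ≤ ∑ z, τ (x, y, z) := fun x y => Finset.sum_nonneg fun z _ => hτ.nonneg _
    refine Finset.sum_le_sum fun x _ => Finset.sum_le_sum fun y _ => Finset.sum_le_sum fun v _ =>
      Finset.sum_le_sum fun a _ => mul_le_mul_of_nonneg_left ?_ (hw0 x y)
    refine mul_le_mul (mul_le_mul (hτ.fst_snd _ _) (hτ.fst_snd _ _) (hw0 _ _) (hW0 _))
      (hτ.fst_snd _ _) (hw0 _ _) (mul_nonneg (hW0 _) (hW0 _))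
  have h2 : ∀ z v, P z v ^ 2 ≤ n * (K z v * L z v) := by
    intro z v
    have ha : P z v ≤ n * K z v := by
      calc P z v ≤ ∑ x, ∑ y, τ (x, y, z) * (n * W (v, y)) :=
            Finset.sum_le_sum fun x _ => Finset.sum_le_sum fun y _ =>
              mul_le_mul_of_nonneg_left (mul_le_mul_of_nonneg_right (hKn _ _) (hW0 _)) (hτ.nonneg _)
        _ = ∑ y, (∑ x, τ (x, y, z)) * (n * W (v, y)) := by
            rw [Finset.sum_comm]
            exact Finset.sum_congr rfl fun y _ => (Finset.sum_mul _ _ _).symm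
        _ ≤ ∑ y, W (y, z) * (n * W (v, y)) :=
            Finset.sum_le_sum fun y _ => mul_le_mul_of_nonneg_right (hτ.snd_thd _ _)
              (mul_nonneg (by positivity) (hW0 _))
        _ = n * K z v := by
            simp only [K]
            rw [Finset.mul_sum]
            exact Finset.sum_congr rfl fun y _ => by rw [hWs y z, hWs v y]; ring
    have hb : P z v ≤ L z v := by
      calc P z v ≤ ∑ x, ∑ y, τ (x, y, z) * K x v :=
            Finset.sum_le_sum fun x _ => Finset.sum_le_sum fun y _ =>
              mul_le_mul_of_nonneg_left (mul_le_of_le_one_right (hK0 _ _) (hW1 _)) (hτ.nonneg _)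
        _ = ∑ x, (∑ y, τ (x, y, z)) * K x v :=
            Finset.sum_congr rfl fun x _ => (Finset.sum_mul _ _ _).symm
        _ ≤ L z v := by
            refine Finset.sum_le_sum fun x _ => mul_le_mul_of_nonneg_right ?_ (hK0 _ _)
            rw [hWs z x]
            exact hτ.fst_thd _ _
    calc P z v ^ 2 = P z v * P z v := sq _
      _ ≤ (n * K z v) * L z v := mul_le_mul ha hb (hP0 _ _) (mul_nonneg (by positivity) (hK0 _ _))
      _ = _ := by ring
  have h3 : (∑ z, ∑ v, P z v) ^ 2 ≤ n ^ 3 * pentagons W W W W W := by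
    have := sq_sum_le_card_mul_sum_sq (s := (Finset.univ : Finset (V × V)))
      (f := fun p => P p.1 p.2)
    rw [Finset.card_univ, Fintype.card_prod, Fintype.sum_prod_type, Fintype.sum_prod_type] at this
    refine this.trans ?_
    have h5 : ∑ z, ∑ v, K z v * L z v = pentagons W W W W W := by
      simp only [K, L, pentagons]
      have e : ∀ z v, (∑ a, W (z, a) * W (a, v)) * ∑ x, W (z, x) * ∑ b, W (x, b) * W (b, v) =
          ∑ a, ∑ x, ∑ b, W (z, a) * W (a, v) * W (v, b) * W (b, x) * W (x, z) := by
        intro z v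
        rw [Finset.sum_mul_sum]
        refine Finset.sum_congr rfl fun a _ => Finset.sum_congr rfl fun x _ => ?_
        rw [← mul_assoc, Finset.mul_sum]
        refine Finset.sum_congr rfl fun b _ => ?_
        rw [hWs v b, hWs b x, hWs x z]; ring
      simp_rw [e]
      refine Finset.sum_congr rfl fun z _ => ?_
      rw [Finset.sum_comm]
      exact Finset.sum_congr rfl fun a _ => Finset.sum_congr rfl fun v _ => Finset.sum_comm
    have h6 : ∑ z, ∑ v, P z v ^ 2 ≤ n * pentagons W W W W W := by
      rw [← h5, Finset.mul_sum]
      refine Finset.sum_le_sum fun z _ => ?_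
      rw [Finset.mul_sum]
      exact Finset.sum_le_sum fun v _ => h2 z v
    push_cast
    calc _ ≤ n * n * (n * pentagons W W W W W) := by gcongr
      _ = _ := by ring
  have h4 : 0 ≤ (∑ x, ∑ y, ∑ z, τ (x, y, z)) ^ 4 := by positivity
  calc (∑ x, ∑ y, ∑ z, τ (x, y, z)) ^ 8 = ((∑ x, ∑ y, ∑ z, τ (x, y, z)) ^ 4) ^ 2 := by ring
    _ ≤ (n ^ 4 * ∑ z, ∑ v, P z v) ^ 2 := pow_le_pow_left₀ h4 h1 2
    _ = n ^ 8 * (∑ z, ∑ v, P z v) ^ 2 := by ring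
    _ ≤ n ^ 8 * (n ^ 3 * pentagons W W W W W) := by gcongr
    _ = _ := by ring

/-- A triangle packing, constant on the classes of `f`, that cannot be enlarged: every triple contains
a saturated pair. -/
lemma exists_maximal_trianglePacking {Q : Type} (f : V → Q) {W : V × V → ℝ}
    (hW0 : ∀ p, 0 ≤ W p)
    (hWf : ∀ x y x' y', f x = f x' → f y = f y' → W (x, y) = W (x', y')) :
    ∃ τ, IsTrianglePacking W τ ∧
      (∀ x y z x' y' z', f x = f x' → f y = f y' → f z = f z' → τ (x, y, z) = τ (x', y', z')) ∧
      ∀ x y z, W (x, y) ≤ ∑ c, τ (x, y, c) ∨ W (x, z) ≤ ∑ b, τ (x, b, z) ∨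
        W (y, z) ≤ ∑ a, τ (a, y, z) := by
  classical
  let F : Set (V × V × V → ℝ) := {τ | IsTrianglePacking W τ ∧
    ∀ x y z x' y' z', f x = f x' → f y = f y' → f z = f z' → τ (x, y, z) = τ (x', y', z')}
  have hclosed : IsClosed F := by
    have : F = (((⋂ t, {τ | 0 ≤ τ t}) ∩ (⋂ x, ⋂ y, {τ | ∑ z, τ (x, y, z) ≤ W (x, y)})) ∩
        ((⋂ x, ⋂ z, {τ | ∑ y, τ (x, y, z) ≤ W (x, z)}) ∩
          (⋂ y, ⋂ z, {τ | ∑ x, τ (x, y, z) ≤ W (y, z)}))) ∩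
        {τ | ∀ x y z x' y' z', f x = f x' → f y = f y' → f z = f z' →
          τ (x, y, z) = τ (x', y', z')} := by
      ext τ
      simp only [F, Set.mem_inter_iff, Set.mem_iInter, Set.mem_ofPred_eq]
      constructor
      · rintro ⟨⟨h1, h2, h3, h4⟩, h5⟩; exact ⟨⟨⟨h1, h2⟩, h3, h4⟩, h5⟩
      · rintro ⟨⟨⟨h1, h2⟩, h3, h4⟩, h5⟩; exact ⟨⟨h1, h2, h3, h4⟩, h5⟩
    rw [this]
    refine ((((isClosed_iInter fun t => ?_).inter (isClosed_iInter fun x => isClosed_iInter fun y =>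
      ?_)).inter ((isClosed_iInter fun x => isClosed_iInter fun y => ?_).inter
      (isClosed_iInter fun x => isClosed_iInter fun y => ?_)))).inter ?_
    · exact isClosed_le continuous_const (continuous_apply _)
    · exact isClosed_le (by fun_prop) continuous_const
    · exact isClosed_le (by fun_prop) continuous_const
    · exact isClosed_le (by fun_prop) continuous_const
    · simp only [Set.ofPred_forall]
      exact isClosed_iInter fun x => isClosed_iInter fun y => isClosed_iInter fun z =>
        isClosed_iInter fun x' => isClosed_iInter fun y' => isClosed_iInter fun z' =>
        isClosed_iInter fun _ => isClosed_iInter fun _ => isClosed_iInter fun _ =>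
        isClosed_eq (continuous_apply _) (continuous_apply _)
  have hcomp : IsCompact F := by
    have hbox : IsCompact (Set.univ.pi fun t : V × V × V => Set.Icc 0 (W (t.1, t.2.1))) :=
      isCompact_univ_pi fun t => isCompact_Icc
    refine hbox.of_isClosed_subset hclosed ?_
    rintro τ ⟨hτ, -⟩ ⟨x, y, z⟩ -
    refine ⟨hτ.nonneg _, le_trans ?_ (hτ.fst_snd x y)⟩
    exact Finset.single_le_sum (f := fun z => τ (x, y, z)) (fun c _ => hτ.nonneg _)
      (Finset.mem_univ z)
  have hne : F.Nonempty := ⟨fun _ => 0, ⟨fun _ => le_rfl, fun x y => by simpa using hW0 _,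
    fun x y => by simpa using hW0 _, fun x y => by simpa using hW0 _⟩, by simp⟩
  obtain ⟨τ, ⟨hτ, hτf⟩, hmax⟩ := hcomp.exists_isMaxOn hne
    (f := fun τ => ∑ t, τ t) (by fun_prop)
  refine ⟨τ, hτ, hτf, ?_⟩
  by_contra! hcon
  obtain ⟨x, y, z, h1, h2, h3⟩ := hcon
  have hn : (0 : ℝ) < Fintype.card V := by exact_mod_cast Fintype.card_pos_iff.2 ⟨x⟩
  set n : ℝ := (Fintype.card V : ℝ) with hn'
  -- All three pairs have room for `s`, so weight `s / n` can be added to every triple of the class.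
  obtain ⟨s, hs, hs1, hs2, hs3⟩ : ∃ s : ℝ, 0 < s ∧ ∑ c, τ (x, y, c) + s ≤ W (x, y) ∧
      ∑ b, τ (x, b, z) + s ≤ W (x, z) ∧ ∑ a, τ (a, y, z) + s ≤ W (y, z) := by
    refine ⟨min (W (x, y) - ∑ c, τ (x, y, c)) (min (W (x, z) - ∑ b, τ (x, b, z))
      (W (y, z) - ∑ a, τ (a, y, z))), by simp [h1, h2, h3], ?_, ?_, ?_⟩
    · linarith [min_le_left (W (x, y) - ∑ c, τ (x, y, c)) (min (W (x, z) - ∑ b, τ (x, b, z))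
        (W (y, z) - ∑ a, τ (a, y, z)))]
    · linarith [(min_le_right (W (x, y) - ∑ c, τ (x, y, c)) (min (W (x, z) - ∑ b, τ (x, b, z))
        (W (y, z) - ∑ a, τ (a, y, z)))).trans (min_le_left _ _)]
    · linarith [(min_le_right (W (x, y) - ∑ c, τ (x, y, c)) (min (W (x, z) - ∑ b, τ (x, b, z))
        (W (y, z) - ∑ a, τ (a, y, z)))).trans (min_le_right _ _)]
  let τ' : V × V × V → ℝ := fun t =>
    τ t + if f t.1 = f x ∧ f t.2.1 = f y ∧ f t.2.2 = f z then s / n else 0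
  have hsn : 0 ≤ s / n := by positivity
  have hsum : ∀ (p : V → Prop) [DecidablePred p], ∑ v, (if p v then s / n else 0) ≤ s := by
    intro p _
    calc ∑ v, (if p v then s / n else 0) ≤ ∑ _v : V, s / n :=
          Finset.sum_le_sum fun v _ => by split_ifs; exacts [le_rfl, hsn]
      _ = s := by
          rw [Finset.sum_const, nsmul_eq_mul, Finset.card_univ, ← hn']; field_simp
  have hτ' : τ' ∈ F := by
    refine ⟨⟨fun t => ?_, fun a b => ?_, fun a c => ?_, fun b c => ?_⟩, ?_⟩
    · refine add_nonneg (hτ.nonneg t) ?_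
      split_ifs; exacts [hsn, le_rfl]
    · simp only [τ']
      rw [Finset.sum_add_distrib]
      by_cases h : f a = f x ∧ f b = f y
      · have e1 : ∑ c, τ (a, b, c) = ∑ c, τ (x, y, c) :=
          Finset.sum_congr rfl fun c _ => hτf _ _ _ _ _ _ h.1 h.2 rfl
        rw [e1, hWf a b x y h.1 h.2]
        linarith [hsum fun c => f a = f x ∧ f b = f y ∧ f c = f z]
      · rw [Finset.sum_eq_zero (s := Finset.univ) (f := fun c =>
          if f a = f x ∧ f b = f y ∧ f c = f z then s / n else 0), add_zero]
        · exact hτ.fst_snd a b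
        · intro c _; rw [if_neg]; tauto
    · simp only [τ']
      rw [Finset.sum_add_distrib]
      by_cases h : f a = f x ∧ f c = f z
      · have e1 : ∑ b, τ (a, b, c) = ∑ b, τ (x, b, z) :=
          Finset.sum_congr rfl fun b _ => hτf _ _ _ _ _ _ h.1 rfl h.2
        rw [e1, hWf a c x z h.1 h.2]
        linarith [hsum fun b => f a = f x ∧ f b = f y ∧ f c = f z]
      · rw [Finset.sum_eq_zero (s := Finset.univ) (f := fun b =>
          if f a = f x ∧ f b = f y ∧ f c = f z then s / n else 0), add_zero]
        · exact hτ.fst_thd a c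
        · intro b _; rw [if_neg]; tauto
    · simp only [τ']
      rw [Finset.sum_add_distrib]
      by_cases h : f b = f y ∧ f c = f z
      · have e1 : ∑ a, τ (a, b, c) = ∑ a, τ (a, y, z) :=
          Finset.sum_congr rfl fun a _ => hτf _ _ _ _ _ _ rfl h.1 h.2
        rw [e1, hWf b c y z h.1 h.2]
        linarith [hsum fun a => f a = f x ∧ f b = f y ∧ f c = f z]
      · rw [Finset.sum_eq_zero (s := Finset.univ) (f := fun a =>
          if f a = f x ∧ f b = f y ∧ f c = f z then s / n else 0), add_zero]
        · exact hτ.snd_thd b c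
        · intro a _; rw [if_neg]; tauto
    · intro a b c a' b' c' ha hb hc
      simp only [τ', hτf a b c a' b' c' ha hb hc, ha, hb, hc]
  have hle : ∑ t, τ' t ≤ ∑ t, τ t := hmax hτ'
  have hlt : ∑ t, τ t < ∑ t, τ' t := by
    refine Finset.sum_lt_sum (fun t _ => ?_) ⟨(x, y, z), Finset.mem_univ _, ?_⟩
    · simp only [τ']
      split_ifs <;> linarith
    · simp only [τ', and_self, if_true]
      have : 0 < s / n := by positivity
      linarith
  linarith

end packing

/-! ### The exponential upper bound for the pentagon -/

/-- Take a weakly regular partition of `G` and remove from its reduced graph all the pairs that are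
saturated by a maximal triangle packing. What is left has no triangle, and the packing is small since
otherwise the reduced graph, and hence `G`, would contain pentagons. -/
lemma isSizeBound_five {ε δ : ℝ} (hε : 0 < ε) (hδ : 0 < δ) (hεδ : 5 * δ ≤ (ε / 3) ^ 8) {K : ℕ}
    (hK : 1 < K * δ ^ 2) :
    IsSizeBound (SimpleGraph.completeGraph (Fin 3)) (SimpleGraph.cycleGraph 5) ε (4 ^ K) := by
  classical
  intro V _ G hG
  set n : ℝ := (Fintype.card V : ℝ) with hn
  let A : V × V → ℝ := fun p => if G.Adj p.1 p.2 then 1 else 0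
  have hA0 : ∀ p, 0 ≤ A p := fun p => by simp only [A]; split_ifs <;> norm_num
  have hA1 : ∀ p, A p ≤ 1 := fun p => by simp only [A]; split_ifs <;> norm_num
  obtain ⟨Q, hQ, f, hcard, hcut⟩ := exists_weakly_regular_map A hA0 hA1 hδ hK
  set W : V × V → ℝ := fibreAvg (Prod.map f f) A with hW
  have hW0 : ∀ p, 0 ≤ W p := fibreAvg_nonneg _ _ hA0
  have hW1 : ∀ p, W p ≤ 1 := fibreAvg_le_one _ _ hA1
  have hWf : ∀ x y x' y', f x = f x' → f y = f y' → W (x, y) = W (x', y') := by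
    intro x y x' y' hx hy
    exact fibreAvg_congr _ _ (by simp [hx, hy])
  have hWs : ∀ x y, W (x, y) = W (y, x) := by
    intro x y
    simp only [hW, fibreAvg]
    congr 1
    · refine Finset.sum_nbij' Prod.swap Prod.swap ?_ ?_ ?_ ?_ ?_
      · rintro ⟨a, b⟩; simp; tauto
      · rintro ⟨a, b⟩; simp; tauto
      · simp
      · simp
      · rintro ⟨a, b⟩ _; simp [A, G.adj_comm]
    · norm_cast
      refine Finset.card_nbij' Prod.swap Prod.swap ?_ ?_ ?_ ?_
      · rintro ⟨a, b⟩; simp; tauto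
      · rintro ⟨a, b⟩; simp; tauto
      · rintro ⟨a, b⟩; simp
      · rintro ⟨a, b⟩; simp
  have hpent : pentagons A A A A A = 0 := by
    unfold pentagons
    refine Finset.sum_eq_zero fun a _ => Finset.sum_eq_zero fun b _ => Finset.sum_eq_zero fun c _ =>
      Finset.sum_eq_zero fun d _ => Finset.sum_eq_zero fun e _ => ?_
    by_contra hne
    have h : G.Adj e a ∧ G.Adj d e ∧ G.Adj c d ∧ G.Adj b c ∧ G.Adj a b := by
      simpa [A, and_assoc] using hne
    obtain ⟨h5, h4, h3, h2, h1⟩ := h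
    refine not_homFree_cycleGraph_of_closedWalk (k := 5) (by norm_num) le_rfl (by simp)
      (fun i => [a, b, c, d, e].getD i a) ?_ h5 hG
    intro i hi
    have : i < 4 := by omega
    interval_cases i
    exacts [h1, h2, h3, h4]
  obtain ⟨τ, hτ, hτf, hτmax⟩ := exists_maximal_trianglePacking f hW0 hWf
  set m : ℝ := ∑ x, ∑ y, ∑ z, τ (x, y, z) with hm
  have hm0 : 0 ≤ m := Finset.sum_nonneg fun x _ => Finset.sum_nonneg fun y _ =>
    Finset.sum_nonneg fun z _ => hτ.nonneg _
  have hn0 : 0 ≤ n := by positivity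
  have hmle : m ≤ ε / 3 * n ^ 2 := by
    have h1 := hτ.pow_eight_le hW0 hW1 hWs
    have h2 := pentagons_le_add hcut (fun p => ⟨hA0 p, hA1 p⟩) (fun p => ⟨hW0 p, hW1 p⟩)
    rw [hpent, zero_add] at h2
    have h3 : m ^ 8 ≤ (ε / 3 * n ^ 2) ^ 8 := by
      calc m ^ 8 ≤ n ^ 11 * (5 * (n ^ 3 * (δ * n ^ 2))) :=
            h1.trans (mul_le_mul_of_nonneg_left h2 (by positivity))
        _ = 5 * δ * n ^ 16 := by ring
        _ ≤ (ε / 3) ^ 8 * n ^ 16 := by gcongr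
        _ = _ := by ring
    exact le_of_pow_le_pow_left₀ (by norm_num) (by positivity) h3
  -- The pairs saturated in one of the three positions.
  let S₁ : V → V → Prop := fun x y => W (x, y) ≤ ∑ z, τ (x, y, z)
  let S₂ : V → V → Prop := fun x y => W (x, y) ≤ ∑ z, τ (x, z, y)
  let S₃ : V → V → Prop := fun x y => W (x, y) ≤ ∑ z, τ (z, x, y)
  let Sat : V → V → Prop := fun x y => S₁ x y ∨ S₂ x y ∨ S₃ x y
  let Bad : V → V → Prop := fun x y => Sat x y ∨ Sat y x
  have hSatf : ∀ x y x' y', f x = f x' → f y = f y' → Sat x y → Sat x' y' := by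
    intro x y x' y' hx hy h
    have e0 := hWf x y x' y' hx hy
    have e1 : ∑ z, τ (x, y, z) = ∑ z, τ (x', y', z) :=
      Finset.sum_congr rfl fun z _ => hτf _ _ _ _ _ _ hx hy rfl
    have e2 : ∑ z, τ (x, z, y) = ∑ z, τ (x', z, y') :=
      Finset.sum_congr rfl fun z _ => hτf _ _ _ _ _ _ hx rfl hy
    have e3 : ∑ z, τ (z, x, y) = ∑ z, τ (z, x', y') :=
      Finset.sum_congr rfl fun z _ => hτf _ _ _ _ _ _ rfl hx hy
    simpa only [Sat, S₁, S₂, S₃, e0, e1, e2, e3] using h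
  have hBadf : ∀ x y x' y', f x = f x' → f y = f y' → Bad x y → Bad x' y' := by
    intro x y x' y' hx hy h
    exact h.imp (hSatf _ _ _ _ hx hy) (hSatf _ _ _ _ hy hx)
  have hBads : ∀ x y, Bad x y → Bad y x := fun x y h => h.symm
  have hmax : ∀ x y z, Bad x y ∨ Bad x z ∨ Bad y z := by
    intro x y z
    rcases hτmax x y z with h | h | h
    · exact Or.inl (Or.inl (Or.inl h))
    · exact Or.inr (Or.inl (Or.inl (Or.inr (Or.inl h))))
    · exact Or.inr (Or.inr (Or.inl (Or.inr (Or.inr h))))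
  let Γ : SimpleGraph Q :=
    { Adj := fun a b => a ≠ b ∧ ∃ u v, f u = a ∧ f v = b ∧ G.Adj u v ∧ ¬ Bad u v
      symm := ⟨fun a b ⟨h1, u, v, h2, h3, h4, h5⟩ =>
        ⟨h1.symm, v, u, h3, h2, h4.symm, fun h => h5 (hBads _ _ h)⟩⟩
      loopless := ⟨fun a h => h.1 rfl⟩ }
  refine ⟨Q, hQ, Γ, f, hcard, ?_, ?_⟩
  · rw [homFree_triangle_iff]
    rintro a b c ⟨-, u₁, u₂, rfl, rfl, -, h12⟩ ⟨-, v₂, u₃, hv₂, rfl, -, h23⟩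
      ⟨-, v₃, v₁, hv₃, hv₁, -, h31⟩
    rcases hmax u₁ u₂ u₃ with h | h | h
    · exact h12 h
    · exact h31 (hBads _ _ (hBadf _ _ _ _ hv₁.symm hv₃.symm h))
    · exact h23 (hBadf _ _ _ _ hv₂.symm rfl h)
  · apply isApproxHom_of_pairs
    have hsub : {p : V × V | G.Adj p.1 p.2 ∧ ¬ Γ.Adj (f p.1) (f p.2)} ⊆
        ((Finset.univ.filter fun p : V × V => G.Adj p.1 p.2 ∧ Bad p.1 p.2 : Finset (V × V)) :
          Set (V × V)) := by
      rintro ⟨u, v⟩ ⟨huv, hΓ⟩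
      simp only [Finset.coe_filter, Finset.mem_univ, true_and, Set.mem_ofPred_eq]
      refine ⟨huv, ?_⟩
      by_contra hb
      refine hΓ ⟨fun he => ?_, u, v, rfl, rfl, huv, hb⟩
      rcases hmax u v u with h | h | h
      · exact hb h
      · exact hb (hBadf _ _ _ _ rfl he h)
      · exact hb (hBads _ _ h)
    have hle := Set.ncard_le_ncard hsub (Set.toFinite _)
    rw [Set.ncard_coe_finset] at hle
    have hle' : ((({p : V × V | G.Adj p.1 p.2 ∧ ¬ Γ.Adj (f p.1) (f p.2)}.ncard : ℕ) : ℝ)) ≤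
        ((Finset.univ.filter fun p : V × V => G.Adj p.1 p.2 ∧ Bad p.1 p.2).card : ℝ) := by
      exact_mod_cast hle
    refine hle'.trans ?_
    have h1 : ((Finset.univ.filter fun p : V × V => G.Adj p.1 p.2 ∧ Bad p.1 p.2).card : ℝ) =
        ∑ x, ∑ y, W (x, y) * (if Bad x y then 1 else 0) := by
      rw [← Fintype.sum_prod_type' (f := fun x y => W (x, y) * (if Bad x y then (1 : ℝ) else 0))]
      rw [sum_fibreAvg_mul (Prod.map f f) A (fun p => if Bad p.1 p.2 then 1 else 0)]
      · rw [Finset.card_filter]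
        push_cast
        refine Finset.sum_congr rfl fun p _ => ?_
        simp only [A]
        by_cases h1 : G.Adj p.1 p.2 <;> by_cases h2 : Bad p.1 p.2 <;> simp [h1, h2]
      · rintro ⟨x, y⟩ ⟨x', y'⟩ h
        simp only [Prod.map_apply, Prod.mk.injEq] at h
        have : Bad x y ↔ Bad x' y' :=
          ⟨hBadf _ _ _ _ h.1 h.2, hBadf _ _ _ _ h.1.symm h.2.symm⟩
        simp only [this]
    rw [h1]
    have hpt : ∀ x y, W (x, y) * (if Bad x y then 1 else 0) ≤
        (∑ z, τ (x, y, z) + ∑ z, τ (x, z, y) + ∑ z, τ (z, x, y)) +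
        (∑ z, τ (y, x, z) + ∑ z, τ (y, z, x) + ∑ z, τ (z, y, x)) := by
      intro x y
      have n1 : ∀ x y, 0 ≤ ∑ z, τ (x, y, z) := fun x y => Finset.sum_nonneg fun z _ => hτ.nonneg _
      have n2 : ∀ x y, 0 ≤ ∑ z, τ (x, z, y) := fun x y => Finset.sum_nonneg fun z _ => hτ.nonneg _
      have n3 : ∀ x y, 0 ≤ ∑ z, τ (z, x, y) := fun x y => Finset.sum_nonneg fun z _ => hτ.nonneg _
      have p1 := n1 x y
      have p2 := n2 x y
      have p3 := n3 x y
      have q1 := n1 y x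
      have q2 := n2 y x
      have q3 := n3 y x
      split_ifs with hb
      · rw [mul_one]
        have hs := hWs x y
        rcases hb with (h | h | h) | (h | h | h) <;> simp only [S₁, S₂, S₃] at h <;> linarith
      · rw [mul_zero]; positivity
    have s1 : ∑ x, ∑ y, ∑ z, τ (x, z, y) = m :=
      Finset.sum_congr rfl fun x _ => Finset.sum_comm
    have s2 : ∑ x, ∑ y, ∑ z, τ (z, x, y) = m :=
      (Finset.sum_congr rfl fun x _ => Finset.sum_comm).trans Finset.sum_comm
    have c1 : ∑ x, ∑ y, ∑ z, τ (y, x, z) = m := Finset.sum_comm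
    have c2 : ∑ x, ∑ y, ∑ z, τ (y, z, x) = m := by
      rw [Finset.sum_comm]; exact s1
    have c3 : ∑ x, ∑ y, ∑ z, τ (z, y, x) = m := by
      rw [Finset.sum_comm]; exact s2
    calc ∑ x, ∑ y, W (x, y) * (if Bad x y then 1 else 0) ≤ _ :=
          Finset.sum_le_sum fun x _ => Finset.sum_le_sum fun y _ => hpt x y
      _ = 6 * m := by
          simp_rw [Finset.sum_add_distrib]
          rw [s1, s2, c1, c2, c3, ← hm]; ring
      _ ≤ 2 * (ε * n ^ 2) := by linarith

lemma triangleCycleSize_five_le {ε : ℝ} (hε : 0 < ε) (hε1 : ε ≤ 1) :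
    (triangleCycleSize 5 ε : ℝ) ≤ (2 : ℝ) ^ (100 * 3 ^ 16 * (1 / ε) ^ (16 : ℝ)) := by
  set δ : ℝ := (ε / 3) ^ 8 / 5 with hδ
  have hδ0 : 0 < δ := by positivity
  set K : ℕ := ⌊1 / δ ^ 2⌋₊ + 1 with hK
  have hKδ : 1 < K * δ ^ 2 := by
    have : 1 / δ ^ 2 < K := by rw [hK]; push_cast; exact Nat.lt_floor_add_one _
    rwa [div_lt_iff₀ (by positivity)] at this
  have h := (isLeast_triangleCycleSize (by norm_num) (by decide) hε).2
    (isSizeBound_five hε hδ0 (by rw [hδ]; linarith) hKδ)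
  have hδ1 : δ ≤ 1 := by
    have : (ε / 3) ^ 8 ≤ 1 := pow_le_one₀ (by positivity) (by linarith)
    rw [hδ]; linarith
  have hKle : (K : ℝ) ≤ 2 * (1 / δ ^ 2) := by
    have h1 : (⌊1 / δ ^ 2⌋₊ : ℝ) ≤ 1 / δ ^ 2 := Nat.floor_le (by positivity)
    have h2 : 1 ≤ 1 / δ ^ 2 := by
      rw [le_div_iff₀ (by positivity), one_mul]
      exact pow_le_one₀ hδ0.le hδ1
    rw [hK]; push_cast; linarith
  calc (triangleCycleSize 5 ε : ℝ) ≤ ((4 ^ K : ℕ) : ℝ) := by exact_mod_cast h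
    _ = (2 : ℝ) ^ ((2 * K : ℕ) : ℝ) := by
        rw [Real.rpow_natCast, pow_mul]; norm_num
    _ ≤ _ := by
        refine Real.rpow_le_rpow_of_exponent_le (by norm_num) ?_
        push_cast
        calc 2 * (K : ℝ) ≤ 2 * (2 * (1 / δ ^ 2)) := by linarith
          _ = 100 * 3 ^ 16 * (1 / ε) ^ 16 := by rw [hδ]; field_simp; norm_num
          _ = _ := by rw [← Real.rpow_natCast (1 / ε) 16]; norm_num

/-! ### Colourings of the cube with few colours -/

section cube
variable {T W : Type} [Fintype T] [DecidableEq T] [Fintype W] [DecidableEq W]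

/-- The number of points of the cube of colour `i` whose coordinate `t` is `b`. -/
def halfCount (g : (T → Bool) → W) (t : T) (b : Bool) (i : W) : ℕ :=
  (Finset.univ.filter fun p => g p = i ∧ p t = b).card

/-- The number of points in the smaller halves, with respect to the coordinate `t`, of the colour
classes. -/
def minorityCount (g : (T → Bool) → W) (t : T) : ℕ :=
  ∑ i, min (halfCount g t true i) (halfCount g t false i)

lemma sum_halfCount_add (g : (T → Bool) → W) (t : T) :
    ∑ i, (halfCount g t true i + halfCount g t false i) = 2 ^ Fintype.card T := by
  have h1 : ∀ i, halfCount g t true i + halfCount g t false i =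
      (Finset.univ.filter fun p => g p = i).card := by
    intro i
    rw [← Finset.card_filter_add_card_filter_not (s := Finset.univ.filter fun p => g p = i)
      (fun p => p t = true)]
    simp [halfCount, Finset.filter_filter]
  simp_rw [h1]
  rw [← Finset.card_eq_sum_card_fiberwise (by simp), Finset.card_univ]
  simp

lemma two_mul_minorityCount_le (g : (T → Bool) → W) (t : T) :
    2 * minorityCount g t ≤ 2 ^ Fintype.card T := by
  rw [← sum_halfCount_add g t, minorityCount, Finset.mul_sum]
  exact Finset.sum_le_sum fun i _ => by omega

/-- Few colours cannot be unbalanced in many coordinates: compare, by convexity of the exponential,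
the number of coordinates in which a point agrees with the majority of its colour class with the same
number for all points of the cube and all colours. -/
lemma pow_card_unbalanced_le (g : (T → Bool) → W) (K : Finset T)
    (hK : ∀ t ∈ K, 4 * minorityCount g t ≤ 2 ^ Fintype.card T) :
    (32 / 25 : ℝ) ^ K.card ≤ (Fintype.card W : ℝ) ^ 2 := by
  set D : ℝ := (2 : ℝ) ^ Fintype.card T with hD
  have hD0 : 0 < D := by positivity
  set k : ℝ := (K.card : ℝ) with hk
  -- `σ i t b` is `1` if the value `b` is in the majority in the class `i`, and `-1` otherwise.
  let σ : W → T → Bool → ℝ := fun i t b =>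
    if halfCount g t (!b) i < halfCount g t b i ∨
      (halfCount g t (!b) i = halfCount g t b i ∧ b = true) then 1 else -1
  have hσ : ∀ i t, σ i t true + σ i t false = 0 ∧
      (2 : ℝ) ^ σ i t true + (2 : ℝ) ^ σ i t false = 2 * (5 / 4) := by
    intro i t
    have h2 : (2 : ℝ) ^ (-1 : ℝ) = 1 / 2 := by rw [Real.rpow_neg_one]; norm_num
    have h1 : (2 : ℝ) ^ (1 : ℝ) = 2 := Real.rpow_one _
    rcases lt_trichotomy (halfCount g t true i) (halfCount g t false i) with h | h | h
    · have e1 : σ i t true = -1 := by simp [σ]; omega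
      have e2 : σ i t false = 1 := by simp [σ, h]
      rw [e1, e2, h1, h2]; norm_num
    · have e1 : σ i t true = 1 := by simp [σ, h]
      have e2 : σ i t false = -1 := by simp [σ, h]
      rw [e1, e2, h1, h2]; norm_num
    · have e1 : σ i t true = 1 := by simp [σ, h]
      have e2 : σ i t false = -1 := by simp [σ]; omega
      rw [e1, e2, h1, h2]; norm_num
  let S : W → (T → Bool) → ℝ := fun i p => ∑ t ∈ K, σ i t (p t)
  have hlow : D * (k / 2) ≤ ∑ p, S (g p) p := by
    have h1 : ∑ p, S (g p) p = ∑ t ∈ K, ∑ p, σ (g p) t (p t) := Finset.sum_comm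
    rw [h1]
    have h2 : ∀ t ∈ K, D / 2 ≤ ∑ p, σ (g p) t (p t) := by
      intro t ht
      have h3 : ∑ p, σ (g p) t (p t) = ∑ i, ((halfCount g t true i : ℝ) + halfCount g t false i
          - 2 * min (halfCount g t true i : ℝ) (halfCount g t false i)) := by
        rw [← Finset.sum_fiberwise (s := Finset.univ) (g := g)]
        refine Finset.sum_congr rfl fun i _ => ?_
        have h4 : ∑ p with g p = i, σ (g p) t (p t) =
            halfCount g t true i * σ i t true + halfCount g t false i * σ i t false := by
          rw [← Finset.sum_filter_add_sum_filter_not _ (fun p => p t = true)]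
          simp only [Finset.filter_filter, halfCount, Bool.not_eq_true]
          congr 1
          · rw [← nsmul_eq_mul]
            refine Finset.sum_eq_card_nsmul fun p hp => ?_
            simp only [Finset.mem_filter, Finset.mem_univ, true_and] at hp
            rw [hp.1, hp.2]
          · rw [← nsmul_eq_mul]
            refine Finset.sum_eq_card_nsmul fun p hp => ?_
            simp only [Finset.mem_filter, Finset.mem_univ, true_and] at hp
            rw [hp.1, hp.2]
        rw [h4]
        rcases lt_trichotomy (halfCount g t true i) (halfCount g t false i) with h | h | h
        · have e1 : σ i t true = -1 := by simp [σ]; omega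
          have e2 : σ i t false = 1 := by simp [σ, h]
          rw [e1, e2, min_eq_left (by exact_mod_cast h.le)]; ring
        · have e1 : σ i t true = 1 := by simp [σ, h]
          have e2 : σ i t false = -1 := by simp [σ, h]
          rw [e1, e2, h, min_self]; ring
        · have e1 : σ i t true = 1 := by simp [σ, h]
          have e2 : σ i t false = -1 := by simp [σ]; omega
          rw [e1, e2, min_eq_right (by exact_mod_cast h.le)]; ring
      have h5 : ((∑ i, (halfCount g t true i + halfCount g t false i) : ℕ) : ℝ) = D := by
        rw [sum_halfCount_add g t, hD]; push_cast; rfl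
      have h6 : 4 * ((minorityCount g t : ℕ) : ℝ) ≤ D := by
        have := hK t ht
        rw [hD]; exact_mod_cast this
      rw [h3, Finset.sum_sub_distrib, ← Finset.mul_sum]
      rw [minorityCount] at h6
      push_cast at h5 h6
      linarith
    calc D * (k / 2) = ∑ t ∈ K, D / 2 := by rw [Finset.sum_const, nsmul_eq_mul]; ring
      _ ≤ _ := Finset.sum_le_sum h2
  have hjensen : D * (2 : ℝ) ^ (k / 2) ≤ ∑ p, (2 : ℝ) ^ S (g p) p := by
    have h1 : ∀ y : ℝ, (2 : ℝ) ^ (k / 2) * (1 + Real.log 2 * (y - k / 2)) ≤ (2 : ℝ) ^ y := by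
      intro y
      have h2 : (2 : ℝ) ^ y = (2 : ℝ) ^ (k / 2) * (2 : ℝ) ^ (y - k / 2) := by
        rw [← Real.rpow_add (by norm_num)]; congr 1; ring
      rw [h2]
      refine mul_le_mul_of_nonneg_left ?_ (by positivity)
      rw [Real.rpow_def_of_pos (by norm_num)]
      linarith [Real.add_one_le_exp (Real.log 2 * (y - k / 2))]
    refine le_trans ?_ (Finset.sum_le_sum fun p _ => h1 (S (g p) p))
    rw [← Finset.mul_sum, Finset.sum_add_distrib, ← Finset.mul_sum, Finset.sum_sub_distrib]
    simp only [Finset.sum_const, nsmul_eq_mul, Finset.card_univ, Fintype.card_fun,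
      Fintype.card_bool, mul_one]
    push_cast
    rw [← hD, mul_comm D]
    refine mul_le_mul_of_nonneg_left ?_ (by positivity)
    have := mul_nonneg (Real.log_nonneg (by norm_num : (1 : ℝ) ≤ 2)) (sub_nonneg.2 hlow)
    linarith
  have hup : ∑ p, (2 : ℝ) ^ S (g p) p ≤ Fintype.card W * (D * (5 / 4) ^ K.card) := by
    have h1 : ∀ i, ∑ p, (2 : ℝ) ^ S i p = D * (5 / 4) ^ K.card := by
      intro i
      have h2 : ∀ p : T → Bool, (2 : ℝ) ^ S i p =
          ∏ t, if t ∈ K then (2 : ℝ) ^ σ i t (p t) else 1 := by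
        intro p
        rw [Finset.prod_ite_mem, Finset.univ_inter]
        exact Real.rpow_sum_of_pos (by norm_num) _ _
      simp_rw [h2]
      have h3 := Finset.prod_univ_sum (fun _ : T => (Finset.univ : Finset Bool))
        (fun t b => if t ∈ K then (2 : ℝ) ^ σ i t b else 1)
      rw [Fintype.piFinset_univ] at h3
      rw [← h3]
      have h4 : ∀ t, ∑ b, (if t ∈ K then (2 : ℝ) ^ σ i t b else 1) =
          2 * if t ∈ K then 5 / 4 else 1 := by
        intro t
        rw [Fintype.sum_bool]
        split_ifs
        · exact (hσ i t).2
        · norm_num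
      simp_rw [h4]
      rw [Finset.prod_mul_distrib, Finset.prod_const, Finset.card_univ, Finset.prod_ite_mem,
        Finset.univ_inter, Finset.prod_const]
    calc ∑ p, (2 : ℝ) ^ S (g p) p ≤ ∑ p, ∑ i, (2 : ℝ) ^ S i p :=
          Finset.sum_le_sum fun p _ => Finset.single_le_sum (f := fun i => (2 : ℝ) ^ S i p)
            (fun i _ => by positivity) (Finset.mem_univ (g p))
      _ = ∑ i, ∑ p, (2 : ℝ) ^ S i p := Finset.sum_comm
      _ = _ := by simp_rw [h1]; rw [Finset.sum_const, nsmul_eq_mul, Finset.card_univ]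
  have hfin : (2 : ℝ) ^ (k / 2) ≤ Fintype.card W * (5 / 4) ^ K.card := by
    refine le_of_mul_le_mul_left ?_ hD0
    calc _ ≤ _ := hjensen.trans hup
      _ = _ := by ring
  have hsq := pow_le_pow_left₀ (by positivity) hfin 2
  have h2k : ((2 : ℝ) ^ (k / 2)) ^ 2 = 2 ^ K.card := by
    rw [← Real.rpow_natCast, ← Real.rpow_mul (by norm_num), ← Real.rpow_natCast, hk]
    congr 1; push_cast; ring
  rw [h2k, mul_pow, ← pow_mul, mul_comm K.card 2, pow_mul] at hsq
  have h3 : (32 / 25 : ℝ) ^ K.card = 2 ^ K.card / ((5 / 4) ^ 2) ^ K.card := by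
    rw [← div_pow]; norm_num
  rw [h3, div_le_iff₀ (by positivity)]
  exact hsq

end cube

/-! ### Blowing up triple systems -/

lemma fin_three_ne_add_one : ∀ j : Fin 3, j ≠ j + 1 := by decide

/-- A linear system of triples, indexed by `T`, with points in `B`. The corners of each triple are
cyclically ordered, and two different triples have at most one point in common. -/
structure TripleSystem (B T : Type) where
  /-- The corners of a triple. -/
  corner : T → Fin 3 → B
  corner_injective : ∀ t, Function.Injective (corner t)
  linear : ∀ t t' i j i' j', i ≠ j → corner t i = corner t' i' → corner t j = corner t' j' → t = t'

namespace TripleSystem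
variable {B T : Type} (𝒮 : TripleSystem B T)

/-- There is an arc from `(u, p)` to `(w, q)` if `w` follows `u` in a triple `t`, the point `p` looks
forward in `t`, and the point `q` looks backward. -/
def Arc (a b : B × (T → Bool)) : Prop :=
  ∃ t j, 𝒮.corner t j = a.1 ∧ 𝒮.corner t (j + 1) = b.1 ∧ a.2 t = true ∧ b.2 t = false

/-- The blow-up of a triple system: every point is replaced by a cube with one coordinate for every
triple, which decides to which of the other two corners of the triple a vertex is joined. So every
triple becomes a union of three complete bipartite graphs without common vertices. -/
def blowUp : SimpleGraph (B × (T → Bool)) where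
  Adj a b := 𝒮.Arc a b ∨ 𝒮.Arc b a
  symm := ⟨fun _ _ h => h.symm⟩
  loopless := ⟨by
    rintro a (⟨t, j, h1, h2, -⟩ | ⟨t, j, h1, h2, -⟩) <;>
    · exact fin_three_ne_add_one j (𝒮.corner_injective t (h1.trans h2.symm))⟩

/-- `Step t u v`: both `u` and `v` are corners of `t`, and they are different. -/
def Step (t : T) (u v : B) : Prop := ∃ i j, i ≠ j ∧ 𝒮.corner t i = u ∧ 𝒮.corner t j = v

variable {𝒮}

lemma Step.ne {t : T} {u v : B} (h : 𝒮.Step t u v) : u ≠ v := by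
  obtain ⟨i, j, hij, rfl, rfl⟩ := h
  exact fun h => hij (𝒮.corner_injective t h)

variable (𝒮)

/-- An edge of the blow-up between cubes at `u` and `v` that comes from the triple `t`. -/
def Link (t : T) (a b : B × (T → Bool)) : Prop :=
  ∃ j, (𝒮.corner t j = a.1 ∧ 𝒮.corner t (j + 1) = b.1 ∧ a.2 t = true ∧ b.2 t = false) ∨
    (𝒮.corner t j = b.1 ∧ 𝒮.corner t (j + 1) = a.1 ∧ b.2 t = true ∧ a.2 t = false)

variable {𝒮}

lemma exists_link {a b : B × (T → Bool)} (h : 𝒮.blowUp.Adj a b) : ∃ t, 𝒮.Link t a b := by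
  rcases h with ⟨t, j, h⟩ | ⟨t, j, h⟩
  · exact ⟨t, j, Or.inl h⟩
  · exact ⟨t, j, Or.inr h⟩

lemma Link.step {t : T} {a b : B × (T → Bool)} (h : 𝒮.Link t a b) : 𝒮.Step t a.1 b.1 := by
  obtain ⟨j, ⟨h1, h2, -⟩ | ⟨h1, h2, -⟩⟩ := h
  · exact ⟨j, j + 1, fin_three_ne_add_one j, h1, h2⟩
  · exact ⟨j + 1, j, (fin_three_ne_add_one j).symm, h2, h1⟩

/-- A walk that uses the same triple in two consecutive steps goes back to the cube it came from. -/
lemma Link.fst_eq {t : T} {a b c : B × (T → Bool)} (h : 𝒮.Link t a b) (h' : 𝒮.Link t b c) :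
    a.1 = c.1 := by
  obtain ⟨j, ⟨h1, h2, h3, h4⟩ | ⟨h1, h2, h3, h4⟩⟩ := h <;>
  obtain ⟨j', ⟨h1', h2', h3', h4'⟩ | ⟨h1', h2', h3', h4'⟩⟩ := h'
  · simp [h4] at h3'
  · have := 𝒮.corner_injective t (h2.trans h2'.symm)
    rw [← h1, ← h1', add_right_cancel this]
  · have := 𝒮.corner_injective t (h1.trans h1'.symm)
    rw [← h2, ← h2', this]
  · simp [h3] at h4'

/-! ### Few colours lose many edges of a blow-up -/

section loss
variable (𝒮)
variable {W : Type}

open scoped Classical in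
/-- The arcs of the blow-up that come from the corners `j` and `j + 1` of the triple `t` and are not
mapped to edges of `Γ` by `f`. -/
noncomputable def lostArcs [Fintype T] (Γ : SimpleGraph W) (f : B × (T → Bool) → W) (t : T)
    (j : Fin 3) : Finset ((T → Bool) × (T → Bool)) :=
  Finset.univ.filter fun x => x.1 t = true ∧ x.2 t = false ∧
    ¬ Γ.Adj (f (𝒮.corner t j, x.1)) (f (𝒮.corner t (j + 1), x.2))

variable {𝒮}

open scoped Classical in
lemma sum_minority_le_card_lostArcs [Fintype T] [Fintype W] {Γ : SimpleGraph W}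
    {f : B × (T → Bool) → W} {t : T} {j j' : Fin 3} (hj : j' = j + 1) :
    (∑ i, ∑ i', if Γ.Adj i i' then 0 else
      min (halfCount (fun p => f (𝒮.corner t j, p)) t true i)
        (halfCount (fun p => f (𝒮.corner t j, p)) t false i) *
      min (halfCount (fun p => f (𝒮.corner t j', p)) t true i')
        (halfCount (fun p => f (𝒮.corner t j', p)) t false i')) ≤ (𝒮.lostArcs Γ f t j).card := by
  subst hj
  rw [Finset.card_eq_sum_card_fiberwise (f := fun x : (T → Bool) × (T → Bool) =>
    (f (𝒮.corner t j, x.1), f (𝒮.corner t (j + 1), x.2))) (t := Finset.univ) (by simp),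
    Fintype.sum_prod_type]
  refine Finset.sum_le_sum fun i _ => Finset.sum_le_sum fun i' _ => ?_
  split_ifs with h
  · exact Nat.zero_le _
  calc _ ≤ halfCount (fun p => f (𝒮.corner t j, p)) t true i *
        halfCount (fun p => f (𝒮.corner t (j + 1), p)) t false i' :=
      Nat.mul_le_mul (min_le_left _ _) (min_le_right _ _)
    _ ≤ _ := by
      rw [halfCount, halfCount, ← Finset.card_product]
      refine Finset.card_le_card ?_
      rintro ⟨p, q⟩ hpq
      simp only [Finset.mem_product, Finset.mem_filter, Finset.mem_univ, true_and] at hpq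
      obtain ⟨⟨hp, hp'⟩, hq, hq'⟩ := hpq
      simp only [lostArcs, Finset.mem_filter, Finset.mem_univ, true_and, Prod.mk.injEq]
      exact ⟨⟨hp', hq', by rwa [hp, hq]⟩, hp, hq⟩

/-- If the colouring of the cubes at the three corners of `t` is balanced in the coordinate `t`, and
`Γ` has no triangle, then a positive proportion of the edges of `t` is lost. -/
lemma le_card_lostArcs [Fintype T] [DecidableEq T] [Fintype W] [DecidableEq W] {Γ : SimpleGraph W}
    (hΓ : ∀ a b c, Γ.Adj a b → Γ.Adj b c → Γ.Adj c a → False) {f : B × (T → Bool) → W} {t : T}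
    (ht : ∀ j, 2 ^ Fintype.card T ≤ 4 * minorityCount (fun p => f (𝒮.corner t j, p)) t) :
    (2 ^ Fintype.card T) ^ 2 ≤ 32 * ∑ j, (𝒮.lostArcs Γ f t j).card := by
  classical
  set D := 2 ^ Fintype.card T with hD
  have hDpos : 0 < D := by positivity
  let μ : Fin 3 → W → ℕ := fun j i => min (halfCount (fun p => f (𝒮.corner t j, p)) t true i)
        (halfCount (fun p => f (𝒮.corner t j, p)) t false i)
  let m : Fin 3 → ℕ := fun j => ∑ i, μ j i
  have hm : ∀ j, m j = minorityCount (fun p => f (𝒮.corner t j, p)) t := by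
    intro j
    simp only [m, μ, minorityCount, halfCount]
  have hm1 : ∀ j, D ≤ 4 * m j := fun j => by rw [hm]; exact ht j
  have hm2 : ∀ j, 2 * m j ≤ D := fun j => by rw [hm]; exact two_mul_minorityCount_le _ _
  let ℓ : Fin 3 → ℕ := fun j => (𝒮.lostArcs Γ f t j).card
  have hl : ∀ j j', j' = j + 1 →
      ∑ i, ∑ i', (if Γ.Adj i i' then 0 else μ j i * μ j' i') ≤ ℓ j := by
    intro j j' hj
    refine le_trans (le_of_eq ?_) (sum_minority_le_card_lostArcs (𝒮 := 𝒮) (Γ := Γ) (f := f) hj)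
    simp only [μ, halfCount]
    congr!
  have h0 := hl 0 1 (by decide)
  have h1 := hl 1 2 (by decide)
  have h2 := hl 2 0 (by decide)
  have hprod : m 0 * m 1 * m 2 ≤ ℓ 0 * m 2 + ℓ 1 * m 0 + ℓ 2 * m 1 := by
    have e : m 0 * m 1 * m 2 = ∑ a, ∑ b, ∑ c, μ 0 a * μ 1 b * μ 2 c := by
      simp only [m]
      rw [Finset.sum_mul_sum, Finset.sum_mul]
      refine Finset.sum_congr rfl fun a _ => ?_
      rw [Finset.sum_mul_sum]
    have f0 : ∑ a, ∑ b, ∑ c, (if Γ.Adj a b then 0 else μ 0 a * μ 1 b) * μ 2 c ≤ ℓ 0 * m 2 := by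
      refine le_trans (le_of_eq ?_) (Nat.mul_le_mul_right _ h0)
      simp only [m]
      rw [Finset.sum_mul]
      refine Finset.sum_congr rfl fun a _ => ?_
      rw [Finset.sum_mul_sum]
    have f1 : ∑ a, ∑ b, ∑ c, (if Γ.Adj b c then 0 else μ 1 b * μ 2 c) * μ 0 a ≤ ℓ 1 * m 0 := by
      refine le_trans (le_of_eq ?_) (Nat.mul_le_mul_right _ h1)
      simp only [m]
      rw [mul_comm, Finset.sum_mul]
      refine Finset.sum_congr rfl fun a _ => ?_
      rw [Finset.mul_sum]
      refine Finset.sum_congr rfl fun b _ => ?_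
      rw [Finset.mul_sum]
      exact Finset.sum_congr rfl fun c _ => mul_comm _ _
    have f2 : ∑ a, ∑ b, ∑ c, (if Γ.Adj c a then 0 else μ 2 c * μ 0 a) * μ 1 b ≤ ℓ 2 * m 1 := by
      refine le_trans (le_of_eq ?_) (Nat.mul_le_mul_right _ h2)
      simp only [m]
      rw [Finset.sum_comm (f := fun c a => if Γ.Adj c a then 0 else μ 2 c * μ 0 a), Finset.sum_mul]
      refine Finset.sum_congr rfl fun a _ => ?_
      rw [mul_comm, Finset.sum_mul_sum]
      exact Finset.sum_congr rfl fun b _ => Finset.sum_congr rfl fun c _ => mul_comm _ _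
    rw [e]
    refine le_trans ?_ (add_le_add (add_le_add f0 f1) f2)
    simp only [← Finset.sum_add_distrib]
    refine Finset.sum_le_sum fun a _ => Finset.sum_le_sum fun b _ => Finset.sum_le_sum fun c _ => ?_
    by_cases hab : Γ.Adj a b
    · by_cases hbc : Γ.Adj b c
      · have hca : ¬ Γ.Adj c a := fun h => hΓ a b c hab hbc h
        simp only [hab, hbc, hca, if_true, if_false]
        exact le_of_eq (by ring)
      · simp only [hab, hbc, if_true, if_false]
        exact le_trans (le_of_eq (by ring)) (Nat.le_add_right _ _)
    · simp only [hab, if_false]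
      exact le_trans (Nat.le_add_right _ _) (Nat.le_add_right _ _)
  have hbig : D ^ 3 ≤ 64 * (m 0 * m 1 * m 2) :=
    calc D ^ 3 = D * D * D := by ring
      _ ≤ (4 * m 0) * (4 * m 1) * (4 * m 2) :=
        Nat.mul_le_mul (Nat.mul_le_mul (hm1 0) (hm1 1)) (hm1 2)
      _ = _ := by ring
  have hsum : ∑ j, (𝒮.lostArcs Γ f t j).card = ℓ 0 + ℓ 1 + ℓ 2 := Fin.sum_univ_three _
  rw [hsum]
  refine Nat.le_of_mul_le_mul_right ?_ hDpos
  have b0 := Nat.mul_le_mul_left (ℓ 0) (hm2 2)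
  have b1 := Nat.mul_le_mul_left (ℓ 1) (hm2 0)
  have b2 := Nat.mul_le_mul_left (ℓ 2) (hm2 1)
  calc D ^ 2 * D = D ^ 3 := by ring
    _ ≤ 64 * (ℓ 0 * m 2 + ℓ 1 * m 0 + ℓ 2 * m 1) := hbig.trans (Nat.mul_le_mul_left _ hprod)
    _ = 32 * (ℓ 0 * (2 * m 2) + ℓ 1 * (2 * m 0) + ℓ 2 * (2 * m 1)) := by ring
    _ ≤ 32 * (ℓ 0 * D + ℓ 1 * D + ℓ 2 * D) := by omega
    _ = _ := by ring

/-- Different triples, corners and points of the cubes give different edges of the blow-up. -/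
lemma sum_card_lostArcs_le [Fintype B] [Fintype T] (Γ : SimpleGraph W) (f : B × (T → Bool) → W) :
    ∑ t, ∑ j, (𝒮.lostArcs Γ f t j).card ≤
      {e ∈ 𝒮.blowUp.edgeSet | Sym2.map f e ∉ Γ.edgeSet}.ncard := by
  classical
  have h1 : ∑ t, ∑ j, (𝒮.lostArcs Γ f t j).card =
      ((Finset.univ : Finset (T × Fin 3)).sigma fun s => 𝒮.lostArcs Γ f s.1 s.2).card := by
    rw [Finset.card_sigma, Fintype.sum_prod_type]
  rw [h1, ← Set.ncard_coe_finset]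
  refine Set.ncard_le_ncard_of_injOn (fun x => s((𝒮.corner x.1.1 x.1.2, x.2.1),
    (𝒮.corner x.1.1 (x.1.2 + 1), x.2.2))) ?_ ?_ (Set.toFinite _)
  · rintro ⟨⟨t, j⟩, p, q⟩ h
    simp only [Finset.coe_sigma, Set.mem_sigma_iff, Finset.mem_coe, lostArcs, Finset.mem_filter,
      Finset.mem_univ, true_and] at h
    refine ⟨Or.inl ⟨t, j, rfl, rfl, h.1, h.2.1⟩, ?_⟩
    simpa using h.2.2
  · rintro ⟨⟨t, j⟩, p, q⟩ - ⟨⟨t', j'⟩, p', q'⟩ - h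
    simp only [Sym2.eq_iff, Prod.mk.injEq] at h
    rcases h with ⟨⟨h1, rfl⟩, h2, rfl⟩ | ⟨⟨h1, rfl⟩, h2, rfl⟩
    · obtain rfl := 𝒮.linear t t' _ _ _ _ (fin_three_ne_add_one j) h1 h2
      obtain rfl := 𝒮.corner_injective t h1
      rfl
    · obtain rfl := 𝒮.linear t t' _ _ _ _ (fin_three_ne_add_one j) h1 h2
      have e1 := 𝒮.corner_injective t h1
      have e2 := 𝒮.corner_injective t h2
      exfalso
      rw [e1] at e2
      revert e2
      clear * -
      decide +revert

/-- Blow-ups need many colours: with few colours most triples are balanced at all their corners, and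
each of these loses a positive proportion of its edges. -/
lemma not_isSizeBound_of_blowUp [Fintype B] [Fintype T] {U : Type} {H : SimpleGraph U}
    {ε : ℝ} {M k : ℕ} (hfree : HomFree H 𝒮.blowUp)
    (hk : 2 * (Fintype.card B * k) ≤ Fintype.card T)
    (hε : ε * (Fintype.card B : ℝ) ^ 2 < (Fintype.card T : ℝ) / 64)
    (hM : (M : ℝ) ^ 2 < (32 / 25) ^ (k + 1)) :
    ¬ IsSizeBound (SimpleGraph.completeGraph (Fin 3)) H ε M := by
  classical
  intro hsize
  obtain ⟨W, hW, Γ, f, hcard, hΓ, hf⟩ := hsize _ 𝒮.blowUp hfree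
  rw [homFree_triangle_iff] at hΓ
  set D := 2 ^ Fintype.card T with hD
  let K : B → Finset T := fun v => Finset.univ.filter fun t =>
    4 * minorityCount (fun p => f (v, p)) t < D
  have hKk : ∀ v, (K v).card ≤ k := by
    intro v
    have h1 := pow_card_unbalanced_le (fun p => f (v, p)) (K v) (by
      intro t ht
      simp only [K, Finset.mem_filter] at ht
      exact ht.2.le)
    have h2 : (Fintype.card W : ℝ) ^ 2 ≤ (M : ℝ) ^ 2 := by gcongr
    have h3 := (h1.trans h2).trans_lt hM
    have := (pow_lt_pow_iff_right₀ (by norm_num : (1 : ℝ) < 32 / 25)).1 h3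
    omega
  let bad : Finset T := Finset.univ.biUnion K
  have hbad : bad.card ≤ Fintype.card B * k := by
    refine Finset.card_biUnion_le.trans ((Finset.sum_le_sum fun v _ => hKk v).trans ?_)
    simp
  have hgood : ∀ t ∈ badᶜ, D ^ 2 ≤ 32 * ∑ j, (𝒮.lostArcs Γ f t j).card := by
    intro t ht
    refine le_card_lostArcs hΓ fun j => ?_
    by_contra! hlt
    rw [Finset.mem_compl] at ht
    exact ht (Finset.mem_biUnion.2 ⟨𝒮.corner t j, Finset.mem_univ _, by simpa [K] using hlt⟩)
  have hcompl : Fintype.card T ≤ 2 * badᶜ.card := by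
    rw [Finset.card_compl]; omega
  have hlost : Fintype.card T * D ^ 2 ≤
      64 * {e ∈ 𝒮.blowUp.edgeSet | Sym2.map f e ∉ Γ.edgeSet}.ncard := by
    calc Fintype.card T * D ^ 2 ≤ 2 * badᶜ.card * D ^ 2 := Nat.mul_le_mul_right _ hcompl
      _ = 2 * ∑ t ∈ badᶜ, D ^ 2 := by rw [Finset.sum_const, smul_eq_mul]; ring
      _ ≤ 2 * ∑ t ∈ badᶜ, 32 * ∑ j, (𝒮.lostArcs Γ f t j).card :=
        Nat.mul_le_mul_left _ (Finset.sum_le_sum hgood)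
      _ = 64 * ∑ t ∈ badᶜ, ∑ j, (𝒮.lostArcs Γ f t j).card := by rw [← Finset.mul_sum]; ring
      _ ≤ 64 * ∑ t, ∑ j, (𝒮.lostArcs Γ f t j).card :=
        Nat.mul_le_mul_left _ (Finset.sum_le_sum_of_subset (Finset.subset_univ _))
      _ ≤ _ := Nat.mul_le_mul_left _ (sum_card_lostArcs_le Γ f)
  have hcardV : (Fintype.card (B × (T → Bool)) : ℝ) = Fintype.card B * D := by
    rw [Fintype.card_prod, Fintype.card_fun, Fintype.card_bool]; push_cast [hD]; rfl
  rw [IsApproxHom, hcardV] at hf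
  have hlost' : (Fintype.card T : ℝ) * (D : ℝ) ^ 2 ≤
      64 * ({e ∈ 𝒮.blowUp.edgeSet | Sym2.map f e ∉ Γ.edgeSet}.ncard : ℕ) := by exact_mod_cast hlost
  have hDpos : (0 : ℝ) < (D : ℝ) ^ 2 := by rw [hD]; positivity
  have h1 : (Fintype.card T : ℝ) / 64 * (D : ℝ) ^ 2 ≤ ε * (Fintype.card B : ℝ) ^ 2 * (D : ℝ) ^ 2 := by
    have : ε * (Fintype.card B * (D : ℝ)) ^ 2 = ε * (Fintype.card B : ℝ) ^ 2 * (D : ℝ) ^ 2 := by ring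
    linarith
  have := le_of_mul_le_mul_right h1 hDpos
  linarith

end loss

/-! ### Short odd closed walks in blow-ups -/

/-- Every triangle of the underlying graph lies in a triple. -/
def TrianglesAreTriples (𝒮 : TripleSystem B T) : Prop :=
  ∀ u v w t₀ t₁ t₂, 𝒮.Step t₀ u v → 𝒮.Step t₁ v w → 𝒮.Step t₂ w u → t₀ = t₁

/-- The underlying graph has no cycle of length `L`. -/
def NoCycle (𝒮 : TripleSystem B T) (L : ℕ) [NeZero L] : Prop :=
  ∀ (v : Fin L → B) (t : Fin L → T), Function.Injective v →
    (∀ i, 𝒮.Step (t i) (v i) (v (i + 1))) → False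

/-- A walk of length three in the blow-up cannot project to a closed walk, even if it is interrupted
by a jump in the cube at one of its inner vertices. -/
lemma TrianglesAreTriples.false_of_path (h : 𝒮.TrianglesAreTriples) {a b c c' d : B × (T → Bool)}
    (hab : 𝒮.blowUp.Adj a b) (hbc : 𝒮.blowUp.Adj b c) (hcd : 𝒮.blowUp.Adj c' d)
    (hc : c'.1 = c.1) (hd : d.1 = a.1) : False := by
  obtain ⟨t₀, h0⟩ := exists_link hab
  obtain ⟨t₁, h1⟩ := exists_link hbc
  obtain ⟨t₂, h2⟩ := exists_link hcd
  have s2 := h2.step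
  rw [hc, hd] at s2
  obtain rfl := h _ _ _ _ _ _ h0.step h1.step s2
  exact s2.ne (h0.fst_eq h1).symm

lemma homFree_three_blowUp (h : 𝒮.TrianglesAreTriples) :
    HomFree (SimpleGraph.cycleGraph 3) 𝒮.blowUp := by
  rw [homFree_cycleGraph_three_iff]
  intro a b c hab hbc hca
  exact h.false_of_path hab hbc hca rfl rfl

/-- A walk of length five in the blow-up cannot project to a closed walk: the projection revisits a
point, and splitting it there leaves a closed walk of length three. -/
lemma false_of_path_five (h3 : 𝒮.TrianglesAreTriples) (h5 : 𝒮.NoCycle 5)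
    {a b c d e a' : B × (T → Bool)} (hab : 𝒮.blowUp.Adj a b) (hbc : 𝒮.blowUp.Adj b c)
    (hcd : 𝒮.blowUp.Adj c d) (hde : 𝒮.blowUp.Adj d e) (hea : 𝒮.blowUp.Adj e a')
    (ha : a'.1 = a.1) : False := by
  have hac : a.1 ≠ c.1 := fun h => h3.false_of_path hcd hde hea rfl (ha.trans h)
  have had : a.1 ≠ d.1 := fun h => h3.false_of_path hab hbc hcd rfl h.symm
  have hbd : b.1 ≠ d.1 := fun h => h3.false_of_path hde hea hab ha.symm h
  have hbe : b.1 ≠ e.1 := fun h => h3.false_of_path hbc hcd hde rfl h.symm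
  have hce : c.1 ≠ e.1 := fun h => h3.false_of_path hab hbc hea h.symm ha
  obtain ⟨t₀, l0⟩ := exists_link hab
  obtain ⟨t₁, l1⟩ := exists_link hbc
  obtain ⟨t₂, l2⟩ := exists_link hcd
  obtain ⟨t₃, l3⟩ := exists_link hde
  obtain ⟨t₄, l4⟩ := exists_link hea
  have s4 := l4.step
  rw [ha] at s4
  refine h5 ![a.1, b.1, c.1, d.1, e.1] ![t₀, t₁, t₂, t₃, t₄] ?_ ?_
  · have n0 := l0.step.ne
    have n1 := l1.step.ne
    have n2 := l2.step.ne
    have n3 := l3.step.ne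
    have n4 := s4.ne
    intro i j hij
    fin_cases i <;> fin_cases j <;>
      simp [n0, n1, n2, n3, n4, hac, had, hbd, hbe, hce, n0.symm, n1.symm, n2.symm, n3.symm,
        n4.symm, hac.symm, had.symm, hbd.symm, hbe.symm, hce.symm] at hij ⊢
  · intro i
    fin_cases i
    exacts [l0.step, l1.step, l2.step, l3.step, s4]

/-- A closed walk of length seven revisits a point of the triple system; splitting it there leaves a
shorter odd closed walk, interrupted only at its base point. -/
lemma homFree_seven_blowUp (h3 : 𝒮.TrianglesAreTriples) (h5 : 𝒮.NoCycle 5) (h7 : 𝒮.NoCycle 7) :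
    HomFree (SimpleGraph.cycleGraph 7) 𝒮.blowUp := by
  refine ⟨fun φ => ?_⟩
  have hadj : ∀ i j : Fin 7, j = i + 1 → 𝒮.blowUp.Adj (φ i) (φ j) := by
    intro i j hij
    refine φ.map_adj ?_
    rw [SimpleGraph.cycleGraph_adj]
    right
    rw [hij, add_sub_cancel_left]
  choose t ht using fun i : Fin 7 => exists_link (hadj i (i + 1) rfl)
  refine h7 (fun i => (φ i).1) t ?_ fun i => (ht i).step
  have k1 : ∀ i, (φ i).1 ≠ (φ (i + 1)).1 := fun i => (ht i).step.ne
  have k2 : ∀ i, (φ i).1 ≠ (φ (i + 2)).1 := by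
    intro i h
    exact false_of_path_five h3 h5 (hadj (i + 2) (i + 3) (by clear * -; decide +revert))
      (hadj (i + 3) (i + 4) (by clear * -; decide +revert)) (hadj (i + 4) (i + 5) (by clear * -; decide +revert))
      (hadj (i + 5) (i + 6) (by clear * -; decide +revert)) (hadj (i + 6) i (by clear * -; decide +revert)) h
  have k3 : ∀ i, (φ i).1 ≠ (φ (i + 3)).1 := by
    intro i h
    exact h3.false_of_path (hadj i (i + 1) rfl) (hadj (i + 1) (i + 2) (by clear * -; decide +revert))
      (hadj (i + 2) (i + 3) (by clear * -; decide +revert)) rfl h.symm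
  intro i j hij
  by_contra hne
  have hcases : ∀ i j : Fin 7, i ≠ j → j = i + 1 ∨ j = i + 2 ∨ j = i + 3 ∨ i = j + 1 ∨ i = j + 2 ∨
      i = j + 3 := by decide
  rcases hcases i j hne with rfl | rfl | rfl | rfl | rfl | rfl
  exacts [k1 _ hij, k2 _ hij, k3 _ hij, k1 _ hij.symm, k2 _ hij.symm, k3 _ hij.symm]

end TripleSystem

/-! ### The lower bound for the triangle -/

/-- The triple system of Ruzsa and Szemerédi: the triples `(x, x + s, x + 2 * s)` with `x < m` and
`s ∈ S`, in three disjoint copies of `{0, …, 3 * m - 1}`. -/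
def ruzsaSzemeredi (m : ℕ) (S : Finset ℕ) (hS : S ⊆ Finset.range m) :
    TripleSystem (Fin 3 × Fin (3 * m)) (Fin m × S) where
  corner t j := (j, ⟨t.1 + j * t.2, by
    have h1 := t.1.2
    have h2 := Finset.mem_range.1 (hS t.2.2)
    have h3 : (j : ℕ) ≤ 2 := by omega
    have h4 : (j : ℕ) * t.2 ≤ 2 * t.2 := Nat.mul_le_mul_right _ h3
    omega⟩)
  corner_injective t i j h := (Prod.ext_iff.1 h).1
  linear := by
    rintro ⟨x, s⟩ ⟨y, r⟩ i j i' j' hij h1 h2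
    simp only [Prod.mk.injEq, Fin.mk.injEq] at h1 h2
    obtain ⟨rfl, h1⟩ := h1
    obtain ⟨rfl, h2⟩ := h2
    have key : (x : ℕ) = y ∧ (s : ℕ) = r := by
      fin_cases i <;> fin_cases j <;> simp at hij h1 h2 <;> omega
    exact Prod.ext (Fin.ext key.1) (Subtype.ext key.2)

/-- A triangle of the underlying graph gives a three-term progression of differences. -/
lemma ruzsaSzemeredi_trianglesAreTriples {m : ℕ} {S : Finset ℕ} (hS : S ⊆ Finset.range m)
    (hfree : ThreeAPFree (S : Set ℕ)) : (ruzsaSzemeredi m S hS).TrianglesAreTriples := by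
  rintro u v w ⟨x₀, s₀⟩ ⟨x₁, s₁⟩ ⟨x₂, s₂⟩ ⟨i, j, hij, rfl, rfl⟩ ⟨j', k, hjk, h1, rfl⟩
    ⟨k', i', hki, h2, h3⟩
  simp only [ruzsaSzemeredi, Prod.mk.injEq, Fin.mk.injEq] at h1 h2 h3
  obtain ⟨rfl, h1⟩ := h1
  obtain ⟨rfl, h2⟩ := h2
  obtain ⟨rfl, h3⟩ := h3
  have hap : ∀ a b c : S, (a : ℕ) + c = b + b → (a : ℕ) = b := fun a b c h =>
    hfree a.2 b.2 c.2 h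
  have a1 := hap s₀ s₁ s₂
  have a2 := hap s₀ s₂ s₁
  have a3 := hap s₁ s₀ s₂
  have key : (x₀ : ℕ) = x₁ ∧ (s₀ : ℕ) = s₁ := by
    fin_cases i' <;> fin_cases j' <;> fin_cases k' <;> simp at hij hjk hki h1 h2 h3 <;> omega
  exact Prod.ext (Fin.ext key.1) (Subtype.ext key.2)

/-- Lower bound in terms of the Roth numbers. -/
lemma pow_le_triangleCycleSize_three {m k : ℕ} {ε : ℝ} (hε : 0 < ε) (hm : 0 < m)
    (hk : 18 * k ≤ rothNumberNat m) (hεm : ε * (5184 * m) < rothNumberNat m) :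
    (32 / 25 : ℝ) ^ (k + 1) ≤ (triangleCycleSize 3 ε : ℝ) ^ 2 := by
  obtain ⟨S, hS, hcard, hfree⟩ := rothNumberNat_spec m
  by_contra! hlt
  have hT : Fintype.card (Fin m × S) = m * rothNumberNat m := by
    rw [Fintype.card_prod, Fintype.card_fin, Fintype.card_coe, hcard]
  have hB : Fintype.card (Fin 3 × Fin (3 * m)) = 9 * m := by
    rw [Fintype.card_prod, Fintype.card_fin, Fintype.card_fin]; ring
  have hm' : (0 : ℝ) < m := by exact_mod_cast hm
  refine TripleSystem.not_isSizeBound_of_blowUp (k := k) (ε := ε)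
    (TripleSystem.homFree_three_blowUp (ruzsaSzemeredi_trianglesAreTriples hS hfree)) ?_ ?_ hlt
    (isLeast_triangleCycleSize le_rfl (by decide) hε).1
  · rw [hT, hB]
    calc 2 * (9 * m * k) = m * (18 * k) := by ring
      _ ≤ _ := Nat.mul_le_mul_left _ hk
  · rw [hT, hB]
    push_cast
    nlinarith

/-! ### Triple systems of large girth -/

section girth
variable {m : ℕ}

/-- The point `u` lies on the triple `t`, which has the corners `(i, t i)`. -/
def OnTriple (t : Fin 3 → Fin m) (u : Fin 3 × Fin m) : Prop := t u.1 = u.2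

open scoped Classical in
/-- The number of triples through a point. -/
noncomputable def tripleDegree (𝒯 : Finset (Fin 3 → Fin m)) (u : Fin 3 × Fin m) : ℕ :=
  (𝒯.filter fun t => OnTriple t u).card

open scoped Classical in
/-- The points at distance at most one from `u`. -/
noncomputable def tripleNbrs (𝒯 : Finset (Fin 3 → Fin m)) (u : Fin 3 × Fin m) :
    Finset (Fin 3 × Fin m) :=
  insert u (Finset.univ.filter fun w => ∃ t ∈ 𝒯, OnTriple t u ∧ OnTriple t w)

open scoped Classical in
/-- The points at distance at most `j` from `u`. -/
noncomputable def tripleBall (𝒯 : Finset (Fin 3 → Fin m)) : ℕ → Fin 3 × Fin m →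
    Finset (Fin 3 × Fin m)
  | 0, u => {u}
  | j + 1, u => (tripleBall 𝒯 j u).biUnion (tripleNbrs 𝒯)

variable {𝒯 : Finset (Fin 3 → Fin m)}

lemma mem_tripleNbrs_comm {u w : Fin 3 × Fin m} : w ∈ tripleNbrs 𝒯 u ↔ u ∈ tripleNbrs 𝒯 w := by
  simp only [tripleNbrs, Finset.mem_insert, Finset.mem_filter, Finset.mem_univ, true_and]
  constructor
  · rintro (rfl | ⟨t, ht, h1, h2⟩)
    exacts [Or.inl rfl, Or.inr ⟨t, ht, h2, h1⟩]
  · rintro (rfl | ⟨t, ht, h1, h2⟩)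
    exacts [Or.inl rfl, Or.inr ⟨t, ht, h2, h1⟩]

lemma self_mem_tripleNbrs (u : Fin 3 × Fin m) : u ∈ tripleNbrs 𝒯 u :=
  Finset.mem_insert_self _ _

lemma mem_tripleBall_succ {j : ℕ} {u w : Fin 3 × Fin m} :
    w ∈ tripleBall 𝒯 (j + 1) u ↔ ∃ x ∈ tripleBall 𝒯 j u, w ∈ tripleNbrs 𝒯 x :=
  Finset.mem_biUnion

lemma mem_tripleBall_succ' {j : ℕ} {u w : Fin 3 × Fin m} :
    w ∈ tripleBall 𝒯 (j + 1) u ↔ ∃ x ∈ tripleNbrs 𝒯 u, w ∈ tripleBall 𝒯 j x := by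
  induction j generalizing w with
  | zero =>
    rw [mem_tripleBall_succ]
    simp only [tripleBall, Finset.mem_singleton, exists_eq_left]
    exact ⟨fun h => ⟨w, h, rfl⟩, by rintro ⟨x, hx, rfl⟩; exact hx⟩
  | succ j ih =>
    rw [mem_tripleBall_succ]
    constructor
    · rintro ⟨y, hy, hw⟩
      obtain ⟨x, hx, hy⟩ := ih.1 hy
      exact ⟨x, hx, mem_tripleBall_succ.2 ⟨y, hy, hw⟩⟩
    · rintro ⟨x, hx, hw⟩
      obtain ⟨y, hy, hw⟩ := mem_tripleBall_succ.1 hw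
      exact ⟨y, ih.2 ⟨x, hx, hy⟩, hw⟩

lemma mem_tripleBall_comm {j : ℕ} {u w : Fin 3 × Fin m} :
    w ∈ tripleBall 𝒯 j u → u ∈ tripleBall 𝒯 j w := by
  induction j generalizing u w with
  | zero =>
    simp only [tripleBall, Finset.mem_singleton]
    exact Eq.symm
  | succ j ih =>
    intro h
    obtain ⟨x, hx, hw⟩ := mem_tripleBall_succ.1 h
    exact mem_tripleBall_succ'.2 ⟨x, mem_tripleNbrs_comm.1 hw, ih hx⟩

lemma tripleBall_mono {i j : ℕ} (hij : i ≤ j) (u : Fin 3 × Fin m) :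
    tripleBall 𝒯 i u ⊆ tripleBall 𝒯 j u := by
  induction hij with
  | refl => exact subset_rfl
  | step _ ih =>
    exact fun w hw => mem_tripleBall_succ.2 ⟨w, ih hw, self_mem_tripleNbrs w⟩

lemma card_tripleNbrs_le {r : ℕ} (hr : ∀ u, tripleDegree 𝒯 u ≤ r) (u : Fin 3 × Fin m) :
    (tripleNbrs 𝒯 u).card ≤ 1 + 3 * r := by
  classical
  have hsub : tripleNbrs 𝒯 u ⊆ insert u ((𝒯.filter fun t => OnTriple t u).biUnion
      fun t => Finset.univ.image fun i => (i, t i)) := by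
    intro w hw
    simp only [tripleNbrs, Finset.mem_insert, Finset.mem_filter, Finset.mem_univ, true_and] at hw
    rcases hw with rfl | ⟨t, ht, h1, h2⟩
    · exact Finset.mem_insert_self _ _
    · refine Finset.mem_insert_of_mem (Finset.mem_biUnion.2 ⟨t, by simp [ht, h1], ?_⟩)
      exact Finset.mem_image.2 ⟨w.1, Finset.mem_univ _, Prod.ext rfl h2⟩
  have hdeg : (𝒯.filter fun t => OnTriple t u).card ≤ r := by
    exact le_trans (le_of_eq (by rw [tripleDegree])) (hr u)
  calc _ ≤ _ := Finset.card_le_card hsub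
    _ ≤ _ + 1 := Finset.card_insert_le _ _
    _ ≤ ∑ t ∈ 𝒯.filter fun t => OnTriple t u, 3 + 1 := by
      refine Nat.add_le_add_right (Finset.card_biUnion_le.trans (Finset.sum_le_sum fun t _ => ?_)) 1
      exact Finset.card_image_le.trans (by simp)
    _ ≤ _ := by rw [Finset.sum_const, smul_eq_mul]; omega

lemma card_tripleBall_le {r : ℕ} (hr : ∀ u, tripleDegree 𝒯 u ≤ r) (j : ℕ) (u : Fin 3 × Fin m) :
    (tripleBall 𝒯 j u).card ≤ (1 + 3 * r) ^ j := by
  induction j with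
  | zero => simp [tripleBall]
  | succ j ih =>
    refine Finset.card_biUnion_le.trans
      ((Finset.sum_le_sum fun w _ => card_tripleNbrs_le hr w).trans ?_)
    rw [Finset.sum_const, smul_eq_mul, pow_succ]
    exact Nat.mul_le_mul_right _ ih

/-- The girth of the triple system exceeds seven: a cycle of length at most seven in the underlying
graph stays in a single triple. For cycles of length two this is linearity. -/
def HasLargeGirth (𝒯 : Finset (Fin 3 → Fin m)) : Prop :=
  ∀ (L : ℕ) [NeZero L], 2 ≤ L → L ≤ 7 → ∀ (v : Fin L → Fin 3 × Fin m) (t : Fin L → Fin 3 → Fin m),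
    Function.Injective v →
    (∀ i, t i ∈ 𝒯 ∧ OnTriple (t i) (v i) ∧ OnTriple (t i) (v (i + 1))) → ∀ i, t i = t 0

open scoped Fin.CommRing in
/-- A new triple whose corners are pairwise far apart creates no short cycle. -/
lemma HasLargeGirth.insert (h : HasLargeGirth 𝒯) {s : Fin 3 → Fin m}
    (hs : ∀ u w, OnTriple s u → OnTriple s w → u ≠ w → w ∉ tripleBall 𝒯 6 u) :
    HasLargeGirth (insert s 𝒯) := by
  intro L _ hL2 hL7 v t hv ht
  by_cases hall : ∀ i, t i = s
  · intro i; rw [hall, hall]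
  by_cases hnone : ∀ i, t i ≠ s
  · refine h L hL2 hL7 v t hv fun i => ⟨?_, (ht i).2⟩
    exact (Finset.mem_insert.1 (ht i).1).resolve_left (hnone i)
  exfalso
  push Not at hall hnone
  -- A maximal stretch of the cycle outside `s` starts after `i`.
  obtain ⟨i, hi, hi'⟩ : ∃ i, t i = s ∧ t (i + 1) ≠ s := by
    by_contra! hcon
    obtain ⟨i₀, hi₀⟩ := hnone
    obtain ⟨i₁, hi₁⟩ := hall
    have hind : ∀ n : ℕ, t (i₀ + (n : Fin L)) = s := by
      intro n
      induction n with
      | zero => simpa using hi₀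
      | succ n ih =>
        have := hcon _ ih
        rwa [add_assoc, ← Nat.cast_succ] at this
    apply hi₁
    have := hind (i₁ - i₀ : Fin L).val
    rwa [Fin.cast_val_eq_self, add_sub_cancel] at this
  have hend : t (i + 1 + ((L - 1 : ℕ) : Fin L)) = s := by
    rw [add_assoc, add_comm 1, ← Nat.cast_succ, show (L - 1).succ = L by omega,
      Fin.natCast_self, add_zero, hi]
  have hex : ∃ j : ℕ, t (i + 1 + (j : Fin L)) = s := ⟨L - 1, hend⟩
  classical
  let j := Nat.find hex
  have hj : t (i + 1 + (j : Fin L)) = s := Nat.find_spec hex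
  have hjmin : ∀ l < j, t (i + 1 + (l : Fin L)) ≠ s := fun l hl => Nat.find_min hex hl
  have hj0 : j ≠ 0 := by
    intro h0
    rw [h0] at hj
    exact hi' (by simpa using hj)
  have hjL : j ≤ L - 1 := Nat.find_min' hex hend
  have hball : ∀ l ≤ j, v (i + 1 + (l : Fin L)) ∈ tripleBall 𝒯 l (v (i + 1)) := by
    intro l
    induction l with
    | zero => simp [tripleBall]
    | succ l ih =>
      intro hl
      refine mem_tripleBall_succ.2 ⟨_, ih (by omega), ?_⟩
      have hstep := ht (i + 1 + (l : Fin L))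
      have hmem := (Finset.mem_insert.1 hstep.1).resolve_left (hjmin l (by omega))
      refine Finset.mem_insert_of_mem (Finset.mem_filter.2 ⟨Finset.mem_univ _, _, hmem, ?_, ?_⟩)
      · exact (ht _).2.1
      · have := (ht (i + 1 + (l : Fin L))).2.2
        rwa [add_assoc (i + 1), ← Nat.cast_succ] at this
  have hmem := tripleBall_mono (show j ≤ 6 by omega) _ (hball j le_rfl)
  have on1 : OnTriple s (v (i + 1)) := by rw [← hi]; exact (ht i).2.2
  have on2 : OnTriple s (v (i + 1 + (j : Fin L))) := by
    have := (ht (i + 1 + (j : Fin L))).2.1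
    rwa [hj] at this
  refine hs _ _ on1 on2 (fun heq => ?_) hmem
  have h1 := hv heq
  have h2 : (j : Fin L) = 0 := by simpa using h1.symm
  rw [Fin.natCast_eq_zero] at h2
  exact hj0 (Nat.eq_zero_of_dvd_of_lt h2 (by omega))

/-- Greedily, there are systems of large girth and bounded degree with many triples: in a maximal one,
all points of one of the three parts that have small degree lie in two balls of radius six. -/
lemma exists_hasLargeGirth (r : ℕ) (hm : m = 4 * (1 + 3 * r) ^ 6) :
    ∃ 𝒯 : Finset (Fin 3 → Fin m), HasLargeGirth 𝒯 ∧ r * m ≤ 2 * 𝒯.card := by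
  classical
  let fam : Finset (Finset (Fin 3 → Fin m)) :=
    Finset.univ.filter fun 𝒯 => HasLargeGirth 𝒯 ∧ ∀ u, tripleDegree 𝒯 u ≤ r
  have hne : fam.Nonempty := by
    refine ⟨∅, ?_⟩
    simp only [fam, Finset.mem_filter, Finset.mem_univ, true_and]
    refine ⟨fun L _ _ _ v t _ ht => ?_, fun u => by simp [tripleDegree]⟩
    exact absurd (ht 0).1 (Finset.notMem_empty _)
  obtain ⟨𝒯, h𝒯, hmax⟩ := fam.exists_max_image Finset.card hne
  obtain ⟨hgirth, hdeg⟩ : HasLargeGirth 𝒯 ∧ ∀ u, tripleDegree 𝒯 u ≤ r := by simpa [fam] using h𝒯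
  refine ⟨𝒯, hgirth, ?_⟩
  set b := (1 + 3 * r) ^ 6 with hb
  let low : Fin 3 → Finset (Fin m) := fun i => Finset.univ.filter fun a => tripleDegree 𝒯 (i, a) < r
  have hballs : ∀ (i : Fin 3) (u : Fin 3 × Fin m),
      (Finset.univ.filter fun a => (i, a) ∈ tripleBall 𝒯 6 u).card ≤ b := by
    intro i u
    refine le_trans ?_ (card_tripleBall_le hdeg 6 u)
    refine Finset.card_le_card_of_injOn (fun a => (i, a)) (fun a ha => by simpa using ha) ?_
    intro a _ a' _ h
    exact (Prod.ext_iff.1 h).2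
  have hlow : ∃ i, (low i).card ≤ 2 * b := by
    by_contra! hcon
    obtain ⟨a₀, h0⟩ : (low 0).Nonempty := Finset.card_pos.1 (by have := hcon 0; omega)
    obtain ⟨a₁, h1, h1'⟩ := Finset.exists_mem_notMem_of_card_lt_card
      (s := Finset.univ.filter fun a => ((1 : Fin 3), a) ∈ tripleBall 𝒯 6 (0, a₀)) (t := low 1)
      (by have := hcon 1; have := hballs 1 (0, a₀); omega)
    obtain ⟨a₂, h2, h2'⟩ := Finset.exists_mem_notMem_of_card_lt_card
      (s := (Finset.univ.filter fun a => ((2 : Fin 3), a) ∈ tripleBall 𝒯 6 (0, a₀)) ∪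
        Finset.univ.filter fun a => ((2 : Fin 3), a) ∈ tripleBall 𝒯 6 (1, a₁)) (t := low 2)
      (by
        have := hcon 2
        have := hballs 2 (0, a₀)
        have := hballs 2 (1, a₁)
        refine (Finset.card_union_le _ _).trans_lt ?_
        omega)
    simp only [Finset.mem_union, Finset.mem_filter, Finset.mem_univ, true_and, not_or] at h1' h2'
    let s : Fin 3 → Fin m := ![a₀, a₁, a₂]
    have hslow : ∀ i, s i ∈ low i := by
      intro i
      fin_cases i
      exacts [h0, h1, h2]
    have hfar : ∀ u w, OnTriple s u → OnTriple s w → u ≠ w → w ∉ tripleBall 𝒯 6 u := by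
      rintro ⟨i, a⟩ ⟨j, c⟩ hu hw hne hball
      simp only [OnTriple] at hu hw
      subst hu hw
      have hball' := mem_tripleBall_comm hball
      fin_cases i <;> fin_cases j
      · exact hne rfl
      · exact h1' hball
      · exact h2'.1 hball
      · exact h1' hball'
      · exact hne rfl
      · exact h2'.2 hball
      · exact h2'.1 hball'
      · exact h2'.2 hball'
      · exact hne rfl
    have hs𝒯 : s ∉ 𝒯 := by
      intro hs
      refine hfar (0, s 0) (1, s 1) rfl rfl (by simp) ?_
      refine tripleBall_mono (show 1 ≤ 6 by norm_num) _ (mem_tripleBall_succ.2 ⟨(0, s 0), ?_, ?_⟩)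
      · simp [tripleBall]
      · exact Finset.mem_insert_of_mem (Finset.mem_filter.2 ⟨Finset.mem_univ _, s, hs, rfl, rfl⟩)
    have hins : insert s 𝒯 ∈ fam := by
      simp only [fam, Finset.mem_filter, Finset.mem_univ, true_and]
      refine ⟨hgirth.insert hfar, fun u => ?_⟩
      by_cases hu : OnTriple s u
      · have hlt : tripleDegree 𝒯 u < r := by
          have := hslow u.1
          simp only [low, Finset.mem_filter, Finset.mem_univ, true_and] at this
          rwa [show s u.1 = u.2 from hu] at this
        simp only [tripleDegree] at hlt ⊢
        rw [Finset.filter_insert, if_pos hu]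
        exact (Finset.card_insert_le _ _).trans hlt
      · simp only [tripleDegree]
        rw [Finset.filter_insert, if_neg hu]
        exact hdeg u
    have := hmax _ hins
    rw [Finset.card_insert_of_notMem hs𝒯] at this
    omega
  obtain ⟨i, hi⟩ := hlow
  have hcount : 𝒯.card = ∑ a, tripleDegree 𝒯 (i, a) := by
    rw [Finset.card_eq_sum_card_fiberwise (f := fun t => t i) (t := Finset.univ) (by simp)]
    refine Finset.sum_congr rfl fun a _ => ?_
    simp only [tripleDegree]
    congr 1
    ext t
    rw [Finset.mem_filter, Finset.mem_filter]
    rfl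
  have hge : r * (low i)ᶜ.card ≤ 𝒯.card := by
    rw [hcount, mul_comm, ← smul_eq_mul, ← Finset.sum_const]
    refine (Finset.sum_le_sum fun a ha => ?_).trans
      (Finset.sum_le_sum_of_subset (Finset.subset_univ (low i)ᶜ))
    simpa [low] using ha
  rw [Finset.card_compl, Fintype.card_fin] at hge
  have hb2 : 2 * b ≤ m - (low i).card := by omega
  calc r * m = 2 * (r * (2 * b)) := by rw [hm]; ring
    _ ≤ 2 * (r * (m - (low i).card)) := by gcongr
    _ ≤ _ := by omega

/-- The triples of a system of large girth, as a linear triple system. -/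
def girthSystem (h : HasLargeGirth 𝒯) : TripleSystem (Fin 3 × Fin m) 𝒯 where
  corner t j := (j, t.1 j)
  corner_injective t i j h := (Prod.ext_iff.1 h).1
  linear := by
    intro t t' i j i' j' hij h1 h2
    simp only [Prod.mk.injEq] at h1 h2
    obtain ⟨rfl, h1⟩ := h1
    obtain ⟨rfl, h2⟩ := h2
    have := h 2 le_rfl (by norm_num) ![(i, t.1 i), (j, t.1 j)] ![t.1, t'.1] (by
      intro a b hab
      fin_cases a <;> fin_cases b <;> simp [hij, hij.symm] at hab ⊢) (by
      intro a
      fin_cases a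
      · exact ⟨t.2, rfl, rfl⟩
      · exact ⟨t'.2, h2.symm, h1.symm⟩) 1
    exact Subtype.ext this.symm

lemma girthSystem_step (h : HasLargeGirth 𝒯) {t : 𝒯} {u w : Fin 3 × Fin m}
    (hs : (girthSystem h).Step t u w) : OnTriple t.1 u ∧ OnTriple t.1 w := by
  obtain ⟨i, j, -, rfl, rfl⟩ := hs
  exact ⟨rfl, rfl⟩

lemma girthSystem_trianglesAreTriples (h : HasLargeGirth 𝒯) :
    (girthSystem h).TrianglesAreTriples := by
  intro u v w t₀ t₁ t₂ s0 s1 s2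
  have n0 := s0.ne
  have n1 := s1.ne
  have n2 := s2.ne
  have := h 3 (by norm_num) (by norm_num) ![u, v, w] ![t₀.1, t₁.1, t₂.1] (by
      intro a b hab
      fin_cases a <;> fin_cases b <;> simp [n0, n1, n2, n0.symm, n1.symm, n2.symm] at hab ⊢) (by
      intro a
      fin_cases a
      · exact ⟨t₀.2, girthSystem_step h s0⟩
      · exact ⟨t₁.2, girthSystem_step h s1⟩
      · exact ⟨t₂.2, girthSystem_step h s2⟩) 1
  exact Subtype.ext this.symm

lemma girthSystem_noCycle (h : HasLargeGirth 𝒯) {L : ℕ} [NeZero L] (hL : 4 ≤ L) (hL' : L ≤ 7) :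
    (girthSystem h).NoCycle L := by
  intro v t hv hs
  have hall := h L (by omega) hL' v (fun i => (t i).1) hv fun i =>
    ⟨(t i).2, girthSystem_step h (hs i)⟩
  -- All points lie on one triple, which has only three corners.
  have hinj : Function.Injective fun i => (v i).1 := by
    intro i j hij
    apply hv
    have h1 := (girthSystem_step h (hs i)).1
    have h2 := (girthSystem_step h (hs j)).1
    have e1 := hall i
    have e2 := hall j
    rw [e1] at h1
    rw [e2] at h2
    refine Prod.ext hij ?_
    rw [← show (t 0).1 (v i).1 = (v i).2 from h1, ← show (t 0).1 (v j).1 = (v j).2 from h2]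
    exact congrArg _ hij
  have := Fintype.card_le_of_injective _ hinj
  simp only [Fintype.card_fin] at this
  omega

/-- Lower bound for the cycle of length seven, with a free parameter. -/
lemma pow_le_triangleCycleSize_seven {r k : ℕ} {ε : ℝ} (hε : 0 < ε) (hr : 0 < r)
    (hk : 12 * k ≤ r) (hεr : ε * (4608 * (1 + 3 * r) ^ 6) < r) :
    (32 / 25 : ℝ) ^ (k + 1) ≤ (triangleCycleSize 7 ε : ℝ) ^ 2 := by
  obtain ⟨m, hm⟩ : ∃ m, m = 4 * (1 + 3 * r) ^ 6 := ⟨_, rfl⟩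
  obtain ⟨𝒯, hg, hcard⟩ := exists_hasLargeGirth r hm
  by_contra! hlt
  have hB : Fintype.card (Fin 3 × Fin m) = 3 * m := by
    rw [Fintype.card_prod, Fintype.card_fin, Fintype.card_fin]
  have hm' : (0 : ℝ) < m := by rw [hm]; positivity
  refine TripleSystem.not_isSizeBound_of_blowUp (k := k) (ε := ε)
    (TripleSystem.homFree_seven_blowUp (girthSystem_trianglesAreTriples hg)
      (girthSystem_noCycle hg (by norm_num) (by norm_num))
      (girthSystem_noCycle hg (by norm_num) (by norm_num))) ?_ ?_ hlt
    (isLeast_triangleCycleSize (by norm_num) (by decide) hε).1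
  · rw [Fintype.card_coe, hB]
    have : 12 * k * m ≤ r * m := Nat.mul_le_mul_right _ hk
    linarith
  · rw [Fintype.card_coe, hB]
    have h1 : (r : ℝ) * m ≤ 2 * (𝒯.card : ℝ) := by exact_mod_cast hcard
    have h2 : ε * (1152 * m) < r := by
      refine lt_of_eq_of_lt ?_ hεr
      rw [hm]; push_cast; ring
    push_cast
    nlinarith

end girth

/-! ### Asymptotics -/

/-- Conversion to powers of two, by `(32 / 25) ^ 3 > 2`. -/
lemma two_rpow_le_of_pow_le {k : ℕ} {x M : ℝ} (hM : 0 ≤ M) (hx : 6 * x ≤ k + 1)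
    (h : (32 / 25 : ℝ) ^ (k + 1) ≤ M ^ 2) : (2 : ℝ) ^ x ≤ M := by
  have h6 : ((2 : ℝ) ^ x) ^ 6 ≤ M ^ 6 := by
    calc ((2 : ℝ) ^ x) ^ 6 = (2 : ℝ) ^ (6 * x) := by
          rw [← Real.rpow_natCast, ← Real.rpow_mul (by norm_num)]; congr 1; push_cast; ring
      _ ≤ (2 : ℝ) ^ ((k + 1 : ℕ) : ℝ) :=
          Real.rpow_le_rpow_of_exponent_le (by norm_num) (by push_cast; exact hx)
      _ = 2 ^ (k + 1) := Real.rpow_natCast _ _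
      _ ≤ ((32 / 25 : ℝ) ^ 3) ^ (k + 1) := pow_le_pow_left₀ (by norm_num) (by norm_num) _
      _ = ((32 / 25 : ℝ) ^ (k + 1)) ^ 3 := by rw [← pow_mul, ← pow_mul, mul_comm]
      _ ≤ (M ^ 2) ^ 3 := pow_le_pow_left₀ (by positivity) h 3
      _ = M ^ 6 := by ring
  exact le_of_pow_le_pow_left₀ (by norm_num) hM h6

lemma eventually_log_inv_ge (R : ℝ) : ∀ᶠ ε : ℝ in 𝓝[>] 0, R ≤ Real.log (1 / ε) := by
  have h := Real.tendsto_log_nhdsGT_zero.eventually (eventually_le_atBot (-R))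
  filter_upwards [h] with ε hε
  rw [one_div, Real.log_inv]
  linarith

/-- Behrend's bound makes the Roth number of `m = exp (log (1 / ε) ^ 2 / 16 + …)` larger than `ε m`
by a constant factor. -/
lemma two_rpow_exp_le_triangleCycleSize_three {ε : ℝ} (hε : 0 < ε)
    (hL : 100 ≤ Real.log (1 / ε)) :
    (2 : ℝ) ^ Real.exp (Real.log (1 / ε) ^ 2 / 32) ≤ (triangleCycleSize 3 ε : ℝ) := by
  set L := Real.log (1 / ε) with hLdef
  have hεL : ε = Real.exp (-L) := by
    rw [hLdef, one_div, Real.log_inv, neg_neg, Real.exp_log hε]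
  set X := Real.exp ((L - 9) ^ 2 / 16) with hX
  have hX1 : 1 ≤ X := Real.one_le_exp (by positivity)
  set m : ℕ := ⌊X⌋₊ with hm
  have hmX : (m : ℝ) ≤ X := Nat.floor_le (by positivity)
  have hm1 : 1 ≤ m := Nat.one_le_floor_iff _ |>.2 hX1
  have hm0 : (0 : ℝ) < m := by exact_mod_cast hm1
  have hXm : X ≤ 2 * m := by
    have h1 : X < m + 1 := Nat.lt_floor_add_one X
    have h2 : (1 : ℝ) ≤ m := by exact_mod_cast hm1
    linarith
  have hsqrt : √(Real.log m) ≤ (L - 9) / 4 := by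
    refine Real.sqrt_le_iff.2 ⟨by linarith, ?_⟩
    calc Real.log m ≤ Real.log X := Real.log_le_log hm0 hmX
      _ = ((L - 9) / 4) ^ 2 := by rw [hX, Real.log_exp]; ring
  have h9 : (5184 : ℝ) < Real.exp 9 := by
    have h1 := Real.exp_one_gt_d9
    have h2 : Real.exp 9 = Real.exp 1 ^ 9 := by rw [← Real.exp_nat_mul]; norm_num
    rw [h2]
    calc (5184 : ℝ) < 2.7 ^ 9 := by norm_num
      _ ≤ _ := pow_le_pow_left₀ (by norm_num) (by linarith) 9
  have hroth : m * (ε * Real.exp 9) ≤ (rothNumberNat m : ℝ) := by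
    refine le_trans (mul_le_mul_of_nonneg_left ?_ hm0.le) Behrend.roth_lower_bound
    rw [hεL, ← Real.exp_add]
    exact Real.exp_le_exp.2 (by linarith)
  have hεm : 0 < ε * m := by positivity
  set k := rothNumberNat m / 18 with hk
  have hkr : (rothNumberNat m : ℝ) ≤ 18 * (k + 1) := by
    have : rothNumberNat m ≤ 18 * (k + 1) := by omega
    exact_mod_cast this
  refine two_rpow_le_of_pow_le (k := k) (by positivity) ?_
    (pow_le_triangleCycleSize_three (m := m) hε (by omega) (by omega) ?_)
  · have h1 : Real.exp (L ^ 2 / 32) ≤ ε * X := by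
      rw [hX, hεL, ← Real.exp_add]
      refine Real.exp_le_exp.2 ?_
      nlinarith
    have h2 : ε * X ≤ 2 * (ε * m) := by nlinarith
    nlinarith
  · nlinarith

lemma one_div_rpow_logb (c : ℝ) {ε : ℝ} (hε : 0 < ε) :
    (1 / ε) ^ (c * Real.logb 2 (1 / ε)) = Real.exp (c / Real.log 2 * Real.log (1 / ε) ^ 2) := by
  rw [Real.rpow_def_of_pos (by positivity), Real.logb]
  congr 1
  ring

/-- The quantitative lower bound for the triangle. -/
lemma eventually_triangleCycleSize_three_ge : ∀ᶠ ε : ℝ in 𝓝[>] 0,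
    (2 : ℝ) ^ ((1 / ε) ^ (Real.log 2 / 32 * Real.logb 2 (1 / ε))) ≤
      (triangleCycleSize 3 ε : ℝ) := by
  filter_upwards [self_mem_nhdsWithin, eventually_log_inv_ge 100] with ε hε hL
  have hε' : 0 < ε := hε
  refine le_trans (le_of_eq ?_) (two_rpow_exp_le_triangleCycleSize_three hε' hL)
  rw [one_div_rpow_logb _ hε']
  have : Real.log 2 ≠ 0 := (Real.log_pos (by norm_num)).ne'
  congr 2
  field_simp

lemma eventually_triangleCycleSize_three_gt {A : ℝ} (hA : 0 < A) (B : ℝ) :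
    ∀ᶠ ε : ℝ in 𝓝[>] 0, (2 : ℝ) ^ (A * (1 / ε) ^ B) < (triangleCycleSize 3 ε : ℝ) := by
  filter_upwards [self_mem_nhdsWithin, eventually_log_inv_ge 100,
    eventually_log_inv_ge (32 * (B + 1)), eventually_log_inv_ge (Real.log A + 1)]
    with ε hε hL hL1 hL2
  have hε' : 0 < ε := hε
  refine lt_of_lt_of_le ?_ (two_rpow_exp_le_triangleCycleSize_three hε' hL)
  refine Real.rpow_lt_rpow_of_exponent_lt (by norm_num) ?_
  rw [Real.rpow_def_of_pos (by positivity)]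
  nth_rewrite 1 [← Real.exp_log hA]
  rw [← Real.exp_add]
  refine Real.exp_lt_exp.2 ?_
  set L := Real.log (1 / ε)
  have : 32 * (B + 1) * L ≤ L * L := mul_le_mul_of_nonneg_right hL1 (by linarith)
  nlinarith

/-- The lower bound for the cycle of length seven. -/
lemma eventually_triangleCycleSize_seven_ge : ∀ᶠ ε : ℝ in 𝓝[>] 0,
    (2 : ℝ) ^ (1 / 144 * (1 / ε) ^ (1 / 6 : ℝ)) ≤ (triangleCycleSize 7 ε : ℝ) := by
  filter_upwards [self_mem_nhdsWithin, eventually_log_inv_ge 120] with ε hε hL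
  have hε' : 0 < ε := hε
  -- In terms of `y = (1 / ε) ^ (1 / 6)`, the degree of the triple system is `⌊y⌋`.
  set y : ℝ := (1 / ε) ^ (1 / 6 : ℝ) with hy
  have hy0 : 0 < y := by positivity
  have hyε : ε * y ^ 6 = 1 := by
    rw [hy, ← Real.rpow_natCast, ← Real.rpow_mul (by positivity)]
    norm_num
    field_simp
  have hybig : (18874368 : ℝ) < y := by
    have h1 : Real.exp 20 ≤ y := by
      rw [hy, Real.rpow_def_of_pos (by positivity)]
      exact Real.exp_le_exp.2 (by linarith)
    have h2 : Real.exp 20 = Real.exp 1 ^ 20 := by rw [← Real.exp_nat_mul]; norm_num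
    have h3 := Real.exp_one_gt_d9
    calc (18874368 : ℝ) < 2.7 ^ 20 := by norm_num
      _ ≤ Real.exp 1 ^ 20 := pow_le_pow_left₀ (by norm_num) (by linarith) 20
      _ ≤ y := by rw [← h2]; exact h1
  set r : ℕ := ⌊y⌋₊ with hr
  have hry : (r : ℝ) ≤ y := Nat.floor_le hy0.le
  have hr1 : 1 ≤ r := Nat.one_le_floor_iff _ |>.2 (by linarith)
  have hr1' : (1 : ℝ) ≤ r := by exact_mod_cast hr1
  have hyr : y ≤ 2 * r := by
    have h1 : y < r + 1 := Nat.lt_floor_add_one y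
    linarith
  set k := r / 12 with hk
  have hkr : (r : ℝ) ≤ 12 * (k + 1) := by
    have : r ≤ 12 * (k + 1) := by omega
    exact_mod_cast this
  refine two_rpow_le_of_pow_le (k := k) (by positivity) (by linarith)
    (pow_le_triangleCycleSize_seven (r := r) hε' (by omega) (by omega) ?_)
  have h1 : (1 + 3 * (r : ℝ)) ^ 6 ≤ (4 * r) ^ 6 := pow_le_pow_left₀ (by positivity) (by linarith) 6
  have h2 : (r : ℝ) ^ 5 ≤ y ^ 5 := pow_le_pow_left₀ (by positivity) hry 5
  have h3 : ε * y ^ 5 * 18874368 < 1 := by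
    rw [← hyε]
    calc ε * y ^ 5 * 18874368 < ε * y ^ 5 * y := mul_lt_mul_of_pos_left hybig (by positivity)
      _ = ε * y ^ 6 := by ring
  calc ε * (4608 * (1 + 3 * (r : ℝ)) ^ 6) ≤ ε * (4608 * (4 * r) ^ 6) := by gcongr
    _ = (ε * (r : ℝ) ^ 5 * 18874368) * r := by ring
    _ ≤ (ε * y ^ 5 * 18874368) * r := by gcongr
    _ < 1 * r := mul_lt_mul_of_pos_right h3 (by linarith)
    _ = r := one_mul _

end AsymHom

theorem theorem1p7 :
    -- for every odd `ℓ ≥ 3` and `ε > 0`, the minimum defining `M_{K₃,C_ℓ}(ε)` exists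
    (∀ ℓ : ℕ, 3 ≤ ℓ → Odd ℓ → ∀ ε : ℝ, 0 < ε →
      IsLeast {M : ℕ | AsymHom.IsSizeBound (SimpleGraph.completeGraph (Fin 3))
        (SimpleGraph.cycleGraph ℓ) ε M} (AsymHom.triangleCycleSize ℓ ε)) ∧
    -- `ℓ = 3`: superexponential, that is, eventually larger than every `2 ^ poly(1/ε)`
    (∀ A B : ℝ, 0 < A → 0 < B → ∀ᶠ ε : ℝ in 𝓝[>] 0,
      (2 : ℝ) ^ (A * (1 / ε) ^ B) < (AsymHom.triangleCycleSize 3 ε : ℝ)) ∧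
    -- `ℓ = 3`, in the quantitative form `2 ^ ((1/ε) ^ Ω(log (1/ε)))`
    (∃ c : ℝ, 0 < c ∧ ∀ᶠ ε : ℝ in 𝓝[>] 0,
      (2 : ℝ) ^ ((1 / ε) ^ (c * Real.logb 2 (1 / ε))) ≤ (AsymHom.triangleCycleSize 3 ε : ℝ)) ∧
    -- `ℓ ∈ {5, 7}`: lower and upper bounds of the form `2 ^ poly(1/ε)`
    (∀ ℓ : ℕ, ℓ = 5 ∨ ℓ = 7 →
      (∃ a b : ℝ, 0 < a ∧ 0 < b ∧ ∀ᶠ ε : ℝ in 𝓝[>] 0,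
        (2 : ℝ) ^ (a * (1 / ε) ^ b) ≤ (AsymHom.triangleCycleSize ℓ ε : ℝ)) ∧
      (∃ A B : ℝ, 0 < A ∧ 0 < B ∧ ∀ ε : ℝ, 0 < ε → ε ≤ 1 →
        (AsymHom.triangleCycleSize ℓ ε : ℝ) ≤ (2 : ℝ) ^ (A * (1 / ε) ^ B))) ∧
    -- odd `ℓ ≥ 9`: linear upper bound
    (∃ C : ℝ, 0 < C ∧ ∀ ℓ : ℕ, 9 ≤ ℓ → Odd ℓ → ∀ ε : ℝ, 0 < ε → ε ≤ 1 →
      (AsymHom.triangleCycleSize ℓ ε : ℝ) ≤ C * (1 / ε)) := by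
  refine ⟨fun ℓ hl ho ε hε => AsymHom.isLeast_triangleCycleSize hl ho hε,
    fun A B hA _ => AsymHom.eventually_triangleCycleSize_three_gt hA B,
    ⟨Real.log 2 / 32, by have := Real.log_pos (show (1 : ℝ) < 2 by norm_num); positivity,
      AsymHom.eventually_triangleCycleSize_three_ge⟩, fun ℓ hl => ?_,
    ⟨2, by norm_num, fun ℓ hl ho ε hε hε1 => AsymHom.triangleCycleSize_le_linear hl ho hε hε1⟩⟩
  -- The size is decreasing in `ℓ`: the case `ℓ = 7` of the lower bound and the case `ℓ = 5` of the
  -- upper bound suffice.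
  have hodd : Odd ℓ := by rcases hl with rfl | rfl <;> decide
  refine ⟨⟨1 / 144, 1 / 6, by norm_num, by norm_num, ?_⟩,
    ⟨100 * 3 ^ 16, 16, by norm_num, by norm_num, fun ε hε hε1 => ?_⟩⟩
  · filter_upwards [self_mem_nhdsWithin, AsymHom.eventually_triangleCycleSize_seven_ge] with ε hε h
    refine h.trans ?_
    exact_mod_cast AsymHom.triangleCycleSize_le_of_le (by omega) (by omega) hodd (by decide) hε
  · refine le_trans ?_ (AsymHom.triangleCycleSize_five_le hε hε1)
    exact_mod_cast AsymHom.triangleCycleSize_le_of_le (by omega) (by omega) (by decide) hodd hε
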